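/- Let $F$ be a non-archimedean local field of characteristic $0$ with ring of integers $\mathcal O$, maximal ideal $\mathfrak p=\varpi\mathcal O$ and residue field of odd cardinality $q$; normalise $|\varpi|=q^{-1}$ and put $\zeta_q(s)=(1-q^{-s})^{-1}$. Let $\psi\colon F\to S^1$ be an unramified continuous additive character (the largest fractional ideal on which it is trivial is $\mathcal O$). Let $G=\mathrm{GL}_2(F)$ and, for $r\ge 1$, $K(r)=1+\mathrm{Mat}_2(\mathfrak p^r)$. For $m,m'\ge 0$ let $$K_H(m,m')=\Big\{\begin{pmatrix} a& \varpi^{m'}b\\ \varpi^m c& d\end{pmatrix}: a,b,c,d\in\mathcal O,\ \det\in\mathcal O^\times\Big\}.$$ For a matrix $\tau$ put $\theta_\tau(k)=\psi(\mathrm{tr}(\tau(k-1)))$, $k\in K(r)$. Let $r\ge1$ and let $\pi$ be a smooth unitary irreducible representation of $G$ with trivial central character and conductor exponent $4r$, i.e. $4r$ is the least $m$ such that $\pi$ has a non-zero $K_H(m,0)$-fixed vector. For $v\in\pi$ put $$Q(v)=\frac1{\mathrm{vol}(K_H(2r,2r))}\int_{K_H(2r,2r)}\langle\pi(k)v,v\rangle\,dk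 .$$ (1) Suppose that $\pi$ is supercuspidal. Let $D\in\mathcal O^\times$ be a non-square and $E=F(\sqrt D)$, the unramified quadratic extension of $F$, with ring of integers $\mathcal O_E$ and $\mathfrak p_E=\varpi\mathcal O_E$, embedded in $\mathrm{Mat}_2(F)$ by $a+b\sqrt D\mapsto\begin{pmatrix}a&b\\bD&a\end{pmatrix}$. Let $\theta\colon E^\times\to S^1$ be a character, trivial on $F^\times$, of conductor exponent $2r$, and let $b_\theta\in\mathfrak p_E^{-2r}$ satisfy $\theta(1+u)=\psi(\mathrm{Tr}_{E/F}(b_\theta u))$ for all $u\in\mathfrak p_E^r$. Let $\Lambda$ be the character $\Lambda(xk)=\theta(x)\theta_{b_\theta}(k)$ ($x\in E^\times$, $k\in K(r)$) of $J=E^\times K(r)$, and suppose that $\pi\cong\text{c-Ind}_J^G(\Lambda)$. A minimal vector is a non-zero $v_{\mathrm{MV}}\in\pi$ with $\pi(j)v_{\mathrm{MV}}=\Lambda(j)v_{\mathrm{MV}}$ for all $j\in J^1=(1+\mathfrak p_E)K(r)$. Minimal vectors exist, and for every minimal vector $$Q\big(v_{\mathrm{MV}}/\|v_{\mathrm{MV}}\|\big)=\zeta_q(1)\,q^{-r}.$$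 (2) Suppose that $\pi\cong\chi\boxplus\chi^{-1}$ is the (normalised) principal series of a unitary character $\chi\colon F^\times\to S^1$ of conductor exponent $2r$. Let $b_\chi\in\mathcal O^\times$ satisfy $\chi(1+\varpi^rx)=\psi(b_\chi x\varpi^{-r})$ for all $x\in\mathcal O$, and put $\tau(\chi)=\varpi^{-2r}\mathrm{diag}(b_\chi,-b_\chi)$. A standard microlocal lift vector is a non-zero $v_{\mathrm{ML}}\in\pi$ with $\pi(dk)v_{\mathrm{ML}}=\chi(t_1/t_2)\,\theta_{\tau(\chi)}(k)\,v_{\mathrm{ML}}$ for all $d=\mathrm{diag}(t_1,t_2)$ with $t_1,t_2\in\mathcal O^\times$ and all $k\in K(r)$. Such vectors exist, and for each of them and every $t\in\mathcal O^\times$, $$Q\big(\pi(c_t)v_{\mathrm{ML}}/\|v_{\mathrm{ML}}\|\big)=\zeta_q(1)\,q^{-r},\qquad c_t=\begin{pmatrix} b_\chi/t&-\tfrac12\\ 1&\tfrac{t}{2b_\chi}\end{pmatrix}.$$ -/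

import Mathlib

open scoped ValuativeRel Matrix
open ValuativeRel MeasureTheory

namespace PadicPeriod

noncomputable section

section Field

set_option linter.unusedSectionVars false

variable {F : Type*} [Field F] [ValuativeRel F] [TopologicalSpace F]

/-- The fractional ideal `𝔭 ^ n = ϖ ^ n 𝒪`, for `n : ℤ`. -/
def primePow (ϖ : 𝒪[F]) (n : ℤ) : Set F :=
  {x | ∃ y : 𝒪[F], x = (ϖ : F) ^ n * (y : F)}

variable (F) in
/-- The cardinality `q` of the residue field. -/
def residueCard : ℕ := Nat.card 𝓀[F]

/-- The local zeta factor `ζ_q(s) = (1 - q ^ (-s))⁻¹`. -/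
def localZeta (q : ℕ) (s : ℂ) : ℂ := (1 - (q : ℂ) ^ (-s))⁻¹

theorem residueCard_ne_zero [IsNonarchimedeanLocalField F] :
    ((residueCard F : ℕ) : NNReal) ≠ 0 :=
  Nat.cast_ne_zero.mpr Nat.card_pos.ne'

/-- The absolute value on `F`, normalised so that a uniformiser has absolute value `q⁻¹`. -/
def normAbs [IsNonarchimedeanLocalField F] (x : F) : ℝ :=
  (WithZeroMulInt.toNNReal (residueCard_ne_zero (F := F))
    (IsNonarchimedeanLocalField.valueGroupWithZeroIsoInt F (valuation F x)) : NNReal)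

/-- `ψ : F → S¹` is a continuous additive character which is unramified: the largest fractional
ideal on which it is trivial is `𝒪`. -/
def IsUnramifiedChar (ψ : AddChar F Circle) : Prop :=
  Continuous ψ ∧ ∀ x : F, (∀ y : 𝒪[F], ψ (x * (y : F)) = 1) ↔ x ∈ 𝒪[F]

/-- The character `χ : Fˣ → S¹` has conductor exponent `a(χ) = m`: `m` is the least natural number
such that `χ` is trivial on `𝒪ˣ ∩ (1 + 𝔭 ^ m)`. -/
def HasCharConductor (ϖ : 𝒪[F]) (χ : Fˣ →* Circle) (m : ℕ) : Prop :=
  IsLeast {n : ℕ | ∀ u : Fˣ, valuation F (u : F) = 1 → (u : F) - 1 ∈ primePow ϖ n → χ u = 1} m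

/-! ### Subgroups of `GL₂(F)` -/

/-- The generalised Hecke congruence subgroup `K_H(m, m')`. -/
def heckeGroup (ϖ : 𝒪[F]) (m m' : ℤ) : Set (GL (Fin 2) F) :=
  {g | g 0 0 ∈ 𝒪[F] ∧ g 0 1 ∈ primePow ϖ m' ∧ g 1 0 ∈ primePow ϖ m ∧ g 1 1 ∈ 𝒪[F] ∧
    valuation F (g : Matrix (Fin 2) (Fin 2) F).det = 1}

/-- The principal congruence subgroup `K(r) = 1 + Mat₂(𝔭 ^ r)`, for `r ≥ 1`. -/
def congruenceGroup (ϖ : 𝒪[F]) (r : ℕ) : Set (GL (Fin 2) F) :=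
  {g | ∀ i j, g i j - (1 : Matrix (Fin 2) (Fin 2) F) i j ∈ primePow ϖ r}

/-- The function `θ_τ(k) = ψ(tr(τ (k - 1)))`. -/
def thetaChar (ψ : AddChar F Circle) (τ : Matrix (Fin 2) (Fin 2) F) (k : GL (Fin 2) F) : Circle :=
  ψ (Matrix.trace (τ * ((k : Matrix (Fin 2) (Fin 2) F) - 1)))

/-! ### Representations of `GL₂(F)` -/

/-- A function on `GL₂(F)` that is right invariant under some open subgroup. -/
def IsRightSmooth (f : GL (Fin 2) F → ℂ) : Prop :=
  ∃ U : Subgroup (GL (Fin 2) F), IsOpen (U : Set (GL (Fin 2) F)) ∧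
    ∀ u ∈ U, ∀ g, f (g * u) = f g

theorem IsRightSmooth.add {f f' : GL (Fin 2) F → ℂ} (h : IsRightSmooth f)
    (h' : IsRightSmooth f') : IsRightSmooth (f + f') := by
  obtain ⟨U, hU, hf⟩ := h
  obtain ⟨U', hU', hf'⟩ := h'
  refine ⟨U ⊓ U', hU.inter hU', fun u hu g => ?_⟩
  simp [hf u hu.1 g, hf' u hu.2 g]

theorem IsRightSmooth.zero : IsRightSmooth (0 : GL (Fin 2) F → ℂ) :=
  ⟨⊤, isOpen_univ, fun _ _ _ => rfl⟩

theorem IsRightSmooth.smul {f : GL (Fin 2) F → ℂ} (c : ℂ) (h : IsRightSmooth f) :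
    IsRightSmooth (c • f) := by
  obtain ⟨U, hU, hf⟩ := h
  exact ⟨U, hU, fun u hu g => by simp [hf u hu g]⟩

section Rep

variable {V : Type*} [NormedAddCommGroup V] [InnerProductSpace ℂ V]

/-- `π` is a smooth unitary (algebraically) irreducible representation on the pre-Hilbert space
`V`, with trivial central character. -/
structure IsSmoothUnitaryIrrep (π : Representation ℂ (GL (Fin 2) F) V) : Prop where
  smooth : ∀ v : V, ∃ U : Subgroup (GL (Fin 2) F), IsOpen (U : Set (GL (Fin 2) F)) ∧
    ∀ u ∈ U, π u v = v
  unitary : ∀ (g : GL (Fin 2) F) (v w : V), inner ℂ (π g v) (π g w) = inner ℂ v w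
  irreducible : π.IsIrreducible
  central : ∀ (z : Fˣ) (v : V), π (Matrix.GeneralLinearGroup.scalar (Fin 2) z) v = v

/-- The conductor exponent of `π` is `n`: `n` is the least natural number such that `π` has a
non-zero vector fixed by `K_H(n) = K_H(n, 0)`. -/
def HasConductorExponent (ϖ : 𝒪[F]) (π : Representation ℂ (GL (Fin 2) F) V) (n : ℕ) : Prop :=
  IsLeast {m : ℕ | ∃ v : V, v ≠ 0 ∧ ∀ k ∈ heckeGroup ϖ m 0, π k v = v} n

/-- `π` is supercuspidal: its Jacquet module with respect to the unipotent radical `N` of the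
standard Borel subgroup vanishes, that is, `V` is spanned by the vectors `π(n) v - v`, `n ∈ N`. -/
def IsSupercuspidal (π : Representation ℂ (GL (Fin 2) F) V) : Prop :=
  Submodule.span ℂ {w : V | ∃ (x : F) (v : V),
    w = π (Matrix.GeneralLinearGroup.upperRightHom x) v - v} = ⊤

/-- `π` is isomorphic to the representation by right translation on a space `W` of functions on
`GL₂(F)`. -/
def IsRealisedOn (π : Representation ℂ (GL (Fin 2) F) V)
    (W : Submodule ℂ (GL (Fin 2) F → ℂ)) : Prop :=
  ∃ Φ : V ≃ₗ[ℂ] W, ∀ (g : GL (Fin 2) F) (v : V) (h : GL (Fin 2) F),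
    (Φ (π g v) : GL (Fin 2) F → ℂ) h = (Φ v : GL (Fin 2) F → ℂ) (h * g)

/-- The local period
`Q(v) = vol(K_H(m, m))⁻¹ ∫_{K_H(m, m)} ⟨π(k) v, v⟩ dk` with `⟨·, ·⟩` linear in the first argument
(so `⟨x, y⟩` is `inner ℂ y x`). -/
def localPeriod [MeasurableSpace (GL (Fin 2) F)] (μ : Measure (GL (Fin 2) F)) (ϖ : 𝒪[F])
    (π : Representation ℂ (GL (Fin 2) F) V) (m : ℕ) (v : V) : ℂ :=
  ((μ.real (heckeGroup ϖ m m) : ℝ) : ℂ)⁻¹ * ∫ k in heckeGroup ϖ m m, inner ℂ v (π k v) ∂μ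

end Rep

/-! ### Supercuspidal representations and minimal vectors -/

/-- The embedding `a + b √D ↦ (a, b; b D, a)` of `E = F(√D)` into the `2 × 2` matrices. -/
def quadMatrix (D : F) : QuadraticAlgebra F D 0 →* Matrix (Fin 2) (Fin 2) F where
  toFun z := !![z.re, z.im; z.im * D, z.re]
  map_one' := by
    ext i j
    fin_cases i <;> fin_cases j <;> simp [QuadraticAlgebra.re_one, QuadraticAlgebra.im_one]
  map_mul' z w := by
    ext i j
    fin_cases i <;> fin_cases j <;> simp [Matrix.mul_apply] <;> ring

/-- The induced embedding of `Eˣ` into `GL₂(F)`. -/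
def quadEmb (D : F) : (QuadraticAlgebra F D 0)ˣ →* GL (Fin 2) F :=
  Units.map (quadMatrix D)

/-- `E = F(√D)` is an unramified quadratic field extension of `F` (in odd residual
characteristic), with `D` a unit. -/
def IsUnramifiedQuadratic (D : F) : Prop :=
  valuation F D = 1 ∧ ¬ IsSquare D

/-- The fractional ideal `𝔭_E ^ n = ϖ ^ n 𝒪_E` of `E = F(√D)`; here `𝒪_E = 𝒪 + 𝒪 √D`. -/
def primePowE (ϖ : 𝒪[F]) (D : F) (n : ℤ) : Set (QuadraticAlgebra F D 0) :=
  {z | z.re ∈ primePow ϖ n ∧ z.im ∈ primePow ϖ n}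

/-- `θ : Eˣ → S¹` is trivial on `Fˣ`, has conductor exponent `a(θ) = 2 r`, and `b ∈ 𝔭_E ^ (-2 r)`
satisfies `θ(1 + u) = ψ(Tr(b u))` for all `u ∈ 𝔭_E ^ r`. -/
structure IsMinimalChar (ψ : AddChar F Circle) (ϖ : 𝒪[F]) (r : ℕ) {D : F}
    (θ : (QuadraticAlgebra F D 0)ˣ →* Circle) (b : QuadraticAlgebra F D 0) : Prop where
  trivial_on_base : ∀ z : Fˣ,
    θ (Units.map (algebraMap F (QuadraticAlgebra F D 0) : F →* QuadraticAlgebra F D 0) z) = 1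
  conductor : IsLeast {n : ℕ | ∀ x : (QuadraticAlgebra F D 0)ˣ,
    (x : QuadraticAlgebra F D 0) ∈ primePowE ϖ D 0 →
    ((x⁻¹ : (QuadraticAlgebra F D 0)ˣ) : QuadraticAlgebra F D 0) ∈ primePowE ϖ D 0 →
    (x : QuadraticAlgebra F D 0) - 1 ∈ primePowE ϖ D n → θ x = 1} (2 * r)
  mem : b ∈ primePowE ϖ D (-(2 * r : ℤ))
  spec : ∀ x : (QuadraticAlgebra F D 0)ˣ,
    (x : QuadraticAlgebra F D 0) - 1 ∈ primePowE ϖ D r →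
    θ x = ψ (QuadraticAlgebra.trace (b * ((x : QuadraticAlgebra F D 0) - 1)))

/-- The compactly induced representation `c-Ind_J^G(Λ)`, `J = Eˣ K(r)`, where `Λ` is the character
`Λ(x k) = θ(x) θ_b(k)`, `x ∈ Eˣ`, `k ∈ K(r)`: smooth functions with `f(j g) = Λ(j) f(g)` for
`j ∈ J`, whose support is contained in `J C` for some compact `C`. -/
def compactInd (ψ : AddChar F Circle) (ϖ : 𝒪[F]) (r : ℕ) {D : F}
    (θ : (QuadraticAlgebra F D 0)ˣ →* Circle) (b : QuadraticAlgebra F D 0) :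
    Submodule ℂ (GL (Fin 2) F → ℂ) where
  carrier := {f | IsRightSmooth f ∧
    (∀ (x : (QuadraticAlgebra F D 0)ˣ), ∀ k ∈ congruenceGroup ϖ r, ∀ g,
      f (quadEmb D x * k * g) = ((θ x * thetaChar ψ (quadMatrix D b) k : Circle) : ℂ) * f g) ∧
    ∃ C : Set (GL (Fin 2) F), IsCompact C ∧ ∀ g, f g ≠ 0 →
      ∃ x : (QuadraticAlgebra F D 0)ˣ, ∃ k ∈ congruenceGroup ϖ r, ∃ c ∈ C,
        g = quadEmb D x * k * c}
  add_mem' := by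
    rintro f f' ⟨hs, hf, C, hC, hsupp⟩ ⟨hs', hf', C', hC', hsupp'⟩
    refine ⟨hs.add hs', fun x k hk g => ?_, C ∪ C', hC.union hC', fun g hg => ?_⟩
    · simp only [Pi.add_apply, hf x k hk g, hf' x k hk g, mul_add]
    · by_cases h : f g = 0
      · have h' : f' g ≠ 0 := fun h' => hg (by simp [h, h'])
        obtain ⟨x, k, hk, c, hc, rfl⟩ := hsupp' g h'
        exact ⟨x, k, hk, c, Or.inr hc, rfl⟩
      · obtain ⟨x, k, hk, c, hc, rfl⟩ := hsupp g h
        exact ⟨x, k, hk, c, Or.inl hc, rfl⟩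
  zero_mem' := ⟨IsRightSmooth.zero, fun _ _ _ _ => by simp, ∅, isCompact_empty,
    fun _ h => absurd rfl h⟩
  smul_mem' := by
    rintro a f ⟨hs, hf, C, hC, hsupp⟩
    refine ⟨hs.smul a, fun x k hk g => ?_, C, hC, fun g hg => hsupp g fun h => hg (by simp [h])⟩
    simp only [Pi.smul_apply, smul_eq_mul, hf x k hk g]
    ring

/-- The non-zero vector `v` is localised at the simple character `(θ̃, J¹)`,
`J¹ = (1 + 𝔭_E) K(r)`, `θ̃(x k) = θ(x) θ_b(k)`. If moreover `π ≅ c-Ind_J^G(Λ)`, this says that `v`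
is a minimal vector attached to the cuspidal type `(Mat₂(𝒪), J, Λ)`. -/
def IsMinimalVector (ψ : AddChar F Circle) (ϖ : 𝒪[F]) (r : ℕ) {D : F}
    (θ : (QuadraticAlgebra F D 0)ˣ →* Circle) (b : QuadraticAlgebra F D 0)
    {V : Type*} [NormedAddCommGroup V] [InnerProductSpace ℂ V]
    (π : Representation ℂ (GL (Fin 2) F) V) (v : V) : Prop :=
  v ≠ 0 ∧ ∀ x : (QuadraticAlgebra F D 0)ˣ,
    (x : QuadraticAlgebra F D 0) - 1 ∈ primePowE ϖ D 1 → ∀ k ∈ congruenceGroup ϖ r,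
      π (quadEmb D x * k) v = ((θ x * thetaChar ψ (quadMatrix D b) k : Circle) : ℂ) • v

/-! ### Principal series and microlocal lift vectors -/

/-- The (normalised) principal series `χ ⊞ χ⁻¹`: smooth functions on `GL₂(F)` with
`f(p g) = χ(t₁ / t₂) |t₁ / t₂| ^ (1 / 2) f(g)` for `p` upper triangular with diagonal
entries `t₁, t₂`. -/
def principalSeries [IsNonarchimedeanLocalField F] (χ : Fˣ →* Circle) :
    Submodule ℂ (GL (Fin 2) F → ℂ) where
  carrier := {f | IsRightSmooth f ∧ ∀ (p : GL (Fin 2) F) (t₁ t₂ : Fˣ),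
    p 0 0 = t₁ → p 1 1 = t₂ → p 1 0 = 0 → ∀ g,
      f (p * g) = (χ (t₁ / t₂) : ℂ) * ((normAbs ((t₁ : F) / t₂) ^ (1 / 2 : ℝ) : ℝ) : ℂ) * f g}
  add_mem' := by
    rintro f f' ⟨hs, hf⟩ ⟨hs', hf'⟩
    refine ⟨hs.add hs', fun p t₁ t₂ h₁ h₂ h₃ g => ?_⟩
    simp only [Pi.add_apply, hf p t₁ t₂ h₁ h₂ h₃ g, hf' p t₁ t₂ h₁ h₂ h₃ g, mul_add]
  zero_mem' := ⟨IsRightSmooth.zero, fun _ _ _ _ _ _ _ => by simp⟩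
  smul_mem' := by
    rintro a f ⟨hs, hf⟩
    refine ⟨hs.smul a, fun p t₁ t₂ h₁ h₂ h₃ g => ?_⟩
    simp only [Pi.smul_apply, smul_eq_mul, hf p t₁ t₂ h₁ h₂ h₃ g]
    ring

/-- `b ∈ 𝒪ˣ` satisfies `χ(1 + ϖ ^ r x) = ψ(b x ϖ ^ (-r))` for all `x ∈ 𝒪`. -/
def IsCharParameter (ψ : AddChar F Circle) (ϖ : 𝒪[F]) (r : ℕ) (χ : Fˣ →* Circle)
    (b : Fˣ) : Prop :=
  valuation F (b : F) = 1 ∧ ∀ (x : 𝒪[F]) (u : Fˣ), (u : F) = 1 + (ϖ : F) ^ r * (x : F) →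
    χ u = ψ ((b : F) * (x : F) * (ϖ : F) ^ (-(r : ℤ)))

/-- The matrix `τ(χ) = ϖ ^ (-2 r) diag(b, -b)`. -/
def tauMatrix (ϖ : 𝒪[F]) (r : ℕ) (b : Fˣ) : Matrix (Fin 2) (Fin 2) F :=
  (ϖ : F) ^ (-(2 * r : ℤ)) • !![(b : F), 0; 0, -(b : F)]

/-- `v` is a standard microlocal lift vector: it is non-zero and localised at the standard
`χ`-type `(D(𝒪) K(r), χ̃)`, where `χ̃(t k) = χ(t₁ / t₂) θ_{τ(χ)}(k)` for `t = diag(t₁, t₂)` in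
`D(𝒪)` and `k ∈ K(r)`. -/
def IsMicrolocalLift (ψ : AddChar F Circle) (ϖ : 𝒪[F]) (r : ℕ) (χ : Fˣ →* Circle) (b : Fˣ)
    {V : Type*} [NormedAddCommGroup V] [InnerProductSpace ℂ V]
    (π : Representation ℂ (GL (Fin 2) F) V) (v : V) : Prop :=
  v ≠ 0 ∧ ∀ (d : GL (Fin 2) F) (t₁ t₂ : Fˣ),
    (d : Matrix (Fin 2) (Fin 2) F) = !![(t₁ : F), 0; 0, (t₂ : F)] →
    valuation F (t₁ : F) = 1 → valuation F (t₂ : F) = 1 → ∀ k ∈ congruenceGroup ϖ r,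
      π (d * k) v = ((χ (t₁ / t₂) * thetaChar ψ (tauMatrix ϖ r b) k : Circle) : ℂ) • v

/-- The matrix `c_t = (b / t, -1 / 2; 1, t / (2 b))`, of determinant one. -/
def translateMatrix [CharZero F] (b t : Fˣ) : GL (Fin 2) F :=
  Matrix.GeneralLinearGroup.mkOfDetNeZero
    !![(b : F) / t, -(1 / 2); 1, (t : F) / (2 * b)] (by
      have hb := b.ne_zero
      have ht := t.ne_zero
      have h : (b : F) / t * ((t : F) / (2 * b)) - -(1 / 2) * 1 = 1 := by
        field_simp
        norm_num
      rw [Matrix.det_fin_two_of, h]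
      exact one_ne_zero)

end Field

end

end PadicPeriod

open PadicPeriod

namespace PadicPeriod

/-! ### Fractional ideals of `F` in terms of the valuation -/

section FractionalIdeals

variable {F : Type*} [Field F] [ValuativeRel F]

/-! Both parts are one computation. Each vector transforms under `K(r)` by a character `θ_τ` whose
parameter is antidiagonal in the sense of `IsAntidiagonalParameter`: `ϖ^{2r} τ` is integral, the
diagonal of `τ` lies in `𝔭^{-r}`, and the upper right entry has exact valuation `-2r`.

Let `k ∈ K_H(2r, 2r)` have diagonal entries `a`, `d`; these are units. If `a ≡ d` modulo `𝔭^r`, then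
`k` is a scalar times an element of `K(r)` on which `θ_τ` is trivial, so `k` fixes `v`
(`IsLocalisedAt.inner_of_mem_heckeSlice`). Otherwise conjugation by `k` rescales the upper right
entry of `τ` by `a / d`, up to terms invisible to `θ_τ`, and so changes the character on lower
unipotents; unitarity then forces `⟨π(k) v, v⟩ = 0` (`IsAntidiagonalParameter.exists_thetaChar_ne`,
`IsLocalisedAt.inner_eq_zero`). Hence `Q` is the proportion of `K_H(2r, 2r)` on which `a ≡ d`,
namely `1 / |(𝒪/𝔭^r)ˣ| = (q^r - q^{r-1})⁻¹` (`measureReal_heckeGroup`, `localZeta_one_mul`).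

For a minimal vector, `τ` is the matrix of `b_θ`: triviality of `θ` on `Fˣ` makes its diagonal
small, and the exact conductor makes its off-diagonal large. For a microlocal lift, `c_t`
diagonalises an antidiagonal matrix, so translation by `c_t` turns `τ(χ)` into that matrix.

Existence is explicit: the inducing character and `θ_τ` agree on the intersection of their groups,
so they glue to a function supported on the product set (`extendChar`), and this function is the
required eigenvector. -/

theorem valuation_uniformizer_ne_zero {ϖ : 𝒪[F]} (hϖ : Irreducible ϖ) :
    valuation F (ϖ : F) ≠ 0 := by
  simpa using hϖ.ne_zero

theorem uniformizer_coe_ne_zero {ϖ : 𝒪[F]} (hϖ : Irreducible ϖ) : (ϖ : F) ≠ 0 := by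
  simpa using hϖ.ne_zero

theorem isUnit_integer_iff (x : 𝒪[F]) : IsUnit x ↔ valuation F (x : F) = 1 :=
  (Valuation.integer.integers (valuation F)).isUnit_iff_valuation_eq_one

theorem valuation_uniformizer_lt_one {ϖ : 𝒪[F]} (hϖ : Irreducible ϖ) :
    valuation F (ϖ : F) < 1 :=
  lt_of_le_of_ne ϖ.2 fun h => hϖ.not_isUnit ((isUnit_integer_iff ϖ).2 h)

theorem mem_primePow_iff {ϖ : 𝒪[F]} (hϖ : Irreducible ϖ) {n : ℤ} {x : F} :
    x ∈ primePow ϖ n ↔ valuation F x ≤ valuation F (ϖ : F) ^ n := by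
  have h0 := uniformizer_coe_ne_zero hϖ
  constructor
  · rintro ⟨y, rfl⟩
    rw [map_mul, map_zpow₀]
    exact mul_le_of_le_one_right' y.2
  · intro h
    have hy : valuation F ((ϖ : F) ^ (-n) * x) ≤ 1 := by
      rw [map_mul, map_zpow₀, zpow_neg, inv_mul_le_iff₀, mul_one]
      · exact h
      · exact zpow_pos (zero_lt_iff.2 (valuation_uniformizer_ne_zero hϖ)) n
    refine ⟨⟨_, hy⟩, ?_⟩
    change x = (ϖ : F) ^ n * ((ϖ : F) ^ (-n) * x)
    rw [zpow_neg, mul_inv_cancel_left₀ (zpow_ne_zero n h0)]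

theorem coe_mem_primePow_iff {ϖ : 𝒪[F]} (x : 𝒪[F]) (n : ℕ) :
    (x : F) ∈ primePow ϖ n ↔ x ∈ Ideal.span {ϖ} ^ n := by
  rw [Ideal.span_singleton_pow, Ideal.mem_span_singleton]
  constructor
  · rintro ⟨y, hy⟩
    exact ⟨y, Subtype.ext (by simpa using hy)⟩
  · rintro ⟨y, rfl⟩
    exact ⟨y, by simp⟩

variable {ϖ : 𝒪[F]} (hϖ : Irreducible ϖ)
include hϖ

theorem mem_primePow_zero_iff {x : F} : x ∈ primePow ϖ 0 ↔ valuation F x ≤ 1 := by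
  simp [mem_primePow_iff hϖ]

theorem primePow_zero_mem (n : ℤ) : (0 : F) ∈ primePow ϖ n := by
  simp [mem_primePow_iff hϖ]

theorem primePow_add_mem {n : ℤ} {x y : F} (hx : x ∈ primePow ϖ n) (hy : y ∈ primePow ϖ n) :
    x + y ∈ primePow ϖ n := by
  rw [mem_primePow_iff hϖ] at *
  exact (Valuation.map_add _ _ _).trans (max_le hx hy)

theorem primePow_neg_mem {n : ℤ} {x : F} (hx : x ∈ primePow ϖ n) : -x ∈ primePow ϖ n := by
  rw [mem_primePow_iff hϖ] at *
  rwa [Valuation.map_neg]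

theorem primePow_sub_mem {n : ℤ} {x y : F} (hx : x ∈ primePow ϖ n) (hy : y ∈ primePow ϖ n) :
    x - y ∈ primePow ϖ n := by
  rw [sub_eq_add_neg]
  exact primePow_add_mem hϖ hx (primePow_neg_mem hϖ hy)

theorem primePow_mul_mem {m n k : ℤ} {x y : F} (hx : x ∈ primePow ϖ m) (hy : y ∈ primePow ϖ n)
    (hk : m + n = k) : x * y ∈ primePow ϖ k := by
  rw [mem_primePow_iff hϖ] at *
  rw [map_mul, ← hk, zpow_add₀ (valuation_uniformizer_ne_zero hϖ)]
  exact mul_le_mul' hx hy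

theorem primePow_mono {m n : ℤ} (h : m ≤ n) : primePow ϖ n ⊆ primePow ϖ m := by
  intro x hx
  rw [mem_primePow_iff hϖ] at *
  exact hx.trans (zpow_le_zpow_right_of_le_one₀
    (zero_lt_iff.2 (valuation_uniformizer_ne_zero hϖ)) (valuation_uniformizer_lt_one hϖ).le h)

theorem primePow_mul_integer {n : ℤ} {x y : F} (hx : x ∈ primePow ϖ n) (hy : valuation F y ≤ 1) :
    x * y ∈ primePow ϖ n :=
  primePow_mul_mem hϖ hx ((mem_primePow_zero_iff hϖ).2 hy) (add_zero n)

theorem primePow_integer_mul {n : ℤ} {x y : F} (hx : valuation F x ≤ 1) (hy : y ∈ primePow ϖ n) :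
    x * y ∈ primePow ϖ n :=
  primePow_mul_mem hϖ ((mem_primePow_zero_iff hϖ).2 hx) hy (zero_add n)

theorem primePow_mul_unit_iff {n : ℤ} {x y : F} (hy : valuation F y = 1) :
    x * y ∈ primePow ϖ n ↔ x ∈ primePow ϖ n := by
  simp [mem_primePow_iff hϖ, hy]

theorem zpow_mul_mem_primePow_iff {m n : ℤ} {x : F} :
    (ϖ : F) ^ m * x ∈ primePow ϖ n ↔ x ∈ primePow ϖ (n - m) := by
  have h := valuation_uniformizer_ne_zero hϖ
  rw [mem_primePow_iff hϖ, mem_primePow_iff hϖ, map_mul, map_zpow₀, zpow_sub₀ h,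
    le_div_iff₀ (zpow_pos (zero_lt_iff.2 h) m), mul_comm]

/-- Discreteness of the valuation: in a valuation ring a non-unit not divisible by `ϖ` would divide
`ϖ` properly, against irreducibility. -/
theorem mem_primePow_one_of_lt {x : F} (hx : valuation F x < 1) : x ∈ primePow ϖ 1 := by
  obtain ⟨y, hy⟩ : ϖ ∣ (⟨x, hx.le⟩ : 𝒪[F]) := by
    have hnu : ¬ IsUnit (⟨x, hx.le⟩ : 𝒪[F]) := fun h => hx.ne ((isUnit_integer_iff _).1 h)
    by_contra hd
    have hle := (ValuationRing.dvd_total ϖ (⟨x, hx.le⟩ : 𝒪[F])).resolve_left hd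
    rcases hϖ.dvd_iff.1 hle with h | h
    · exact hnu h
    · exact hd h.dvd
  refine ⟨y, ?_⟩
  rw [zpow_one]
  exact congrArg Subtype.val hy

theorem valuation_lt_one_of_mem {x : F} (hx : x ∈ primePow ϖ 1) : valuation F x < 1 := by
  rw [mem_primePow_iff hϖ, zpow_one] at hx
  exact hx.trans_lt (valuation_uniformizer_lt_one hϖ)

theorem valuation_eq_one_of_sub_mem {x y : F} {n : ℤ} (hn : 1 ≤ n) (h : x - y ∈ primePow ϖ n)
    (hy : valuation F y = 1) : valuation F x = 1 := by
  have h1 : valuation F (x - y) < valuation F y := by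
    rw [hy]
    exact valuation_lt_one_of_mem hϖ (primePow_mono hϖ hn h)
  rw [← sub_add_cancel x y, Valuation.map_add_eq_of_lt_right (valuation F) h1, hy]

theorem isOpen_primePow [TopologicalSpace F] [IsNonarchimedeanLocalField F] (n : ℤ) :
    IsOpen (primePow ϖ n) := by
  have h : primePow ϖ n = {x : F | (valuation F).restrict x ≤ (valuation F).restrict ((ϖ : F) ^ n)} := by
    ext x
    rw [mem_primePow_iff hϖ, Set.mem_ofPred_eq, Valuation.restrict_le_iff, map_zpow₀]
  rw [h]
  apply Valuation.isOpen_closedBall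
  rw [Valuation.ne_zero_iff]
  exact zpow_ne_zero _ (uniformizer_coe_ne_zero hϖ)

end FractionalIdeals

/-! ### Odd residue characteristic, Hensel's lemma and residue classes -/

section LocalField

variable {F : Type*} [Field F] [ValuativeRel F] [TopologicalSpace F] [IsNonarchimedeanLocalField F]

theorem valuation_two_eq_one (hres : ringChar 𝓀[F] ≠ 2) : valuation F (2 : F) = 1 := by
  have h : IsUnit (2 : 𝒪[F]) := by
    by_contra h
    have h2 : (2 : 𝓀[F]) = 0 := by
      rw [← map_ofNat (IsLocalRing.residue 𝒪[F]) 2]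
      exact (IsLocalRing.residue_eq_zero_iff _).2 h
    have hd : ringChar 𝓀[F] ∣ 2 := (ringChar.spec 𝓀[F] 2).1 (by exact_mod_cast h2)
    rcases (Nat.dvd_prime Nat.prime_two).1 hd with h1 | h1
    · exact CharP.ringChar_ne_one h1
    · exact hres h1
  exact (isUnit_integer_iff (2 : 𝒪[F])).1 h

/-- Hensel's lemma for square roots of units in odd residue characteristic. -/
theorem isSquare_of_valuation_sq_sub_lt_one (hres : ringChar 𝓀[F] ≠ 2) {D u : F}
    (hD : valuation F D = 1) (h : valuation F (u ^ 2 - D) < 1) : IsSquare D := by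
  have hu : valuation F u = 1 := by
    have h1 : valuation F (u ^ 2) = 1 := by
      rw [← sub_add_cancel (u ^ 2) D, Valuation.map_add_eq_of_lt_right (valuation F) (by rwa [hD]), hD]
    rw [map_pow] at h1
    exact (pow_eq_one_iff.1 h1).resolve_right two_ne_zero
  let := IsTopologicalAddGroup.rightUniformSpace F
  have := isUniformAddGroup_of_addCommGroup (G := F)
  have hen : HenselianRing 𝒪[F] 𝓂[F] := IsAdicComplete.henselianRing _ _
  let D' : 𝒪[F] := ⟨D, hD.le⟩
  let u' : 𝒪[F] := ⟨u, hu.le⟩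
  obtain ⟨a, ha, -⟩ := hen.is_henselian (Polynomial.X ^ 2 - Polynomial.C D')
    (Polynomial.monic_X_pow_sub_C D' two_ne_zero) u'
    (by
      rw [IsLocalRing.mem_maximalIdeal, mem_nonunits_iff, isUnit_integer_iff]
      simpa using h.ne)
    (by
      -- The derivative `2u` is a unit because `2` and `u` are.
      refine IsUnit.map _ ((isUnit_integer_iff _).2 ?_)
      have h2 : valuation F ((2 : 𝒪[F]) : F) = 1 := valuation_two_eq_one hres
      simp [one_add_one_eq_two, h2, u', hu])
  refine ⟨(a : F), ?_⟩
  simp only [Polynomial.IsRoot, Polynomial.eval_sub, Polynomial.eval_pow, Polynomial.eval_X,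
    Polynomial.eval_C, sub_eq_zero] at ha
  have := congrArg (Subtype.val : 𝒪[F] → F) ha
  simpa [D', pow_two] using this.symm

theorem card_quotient_span_pow {ϖ : 𝒪[F]} (hϖ : Irreducible ϖ) (n : ℕ) :
    Nat.card (𝒪[F] ⧸ Ideal.span {ϖ} ^ n) = residueCard F ^ n := by
  have hmax : Ideal.span {ϖ} = 𝓂[F] := hϖ.maximalIdeal_eq.symm
  rw [hmax, ← Submodule.cardQuot_apply, cardQuot_pow_of_prime, Submodule.cardQuot_apply]
  · rfl
  · exact IsDiscreteValuationRing.not_a_field _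

/-- Representatives in `𝒪ˣ` of `(𝒪 / 𝔭 ^ n)ˣ`. -/
theorem exists_unit_representatives {ϖ : 𝒪[F]} (hϖ : Irreducible ϖ) {n : ℕ} (hn : 1 ≤ n) :
    ∃ T : Finset F, T.card = residueCard F ^ n - residueCard F ^ (n - 1) ∧
      (∀ t ∈ T, valuation F t = 1) ∧
      (∀ t ∈ T, ∀ t' ∈ T, t - t' ∈ primePow ϖ n → t = t') ∧
      ∀ x : F, valuation F x = 1 → ∃ t ∈ T, x - t ∈ primePow ϖ n := by
  classical
  have hq : 0 < residueCard F := Nat.card_pos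
  have hcard := card_quotient_span_pow hϖ n
  have hfin : Finite (𝒪[F] ⧸ Ideal.span {ϖ} ^ n) :=
    Nat.finite_of_card_ne_zero (by rw [hcard]; positivity)
  have := Fintype.ofFinite (𝒪[F] ⧸ Ideal.span {ϖ} ^ n)
  have hle : ∀ a ∈ Ideal.span {ϖ} ^ n, IsLocalRing.residue 𝒪[F] a = 0 := fun a ha => by
    rw [IsLocalRing.residue_eq_zero_iff, hϖ.maximalIdeal_eq]
    exact Ideal.pow_le_self (by omega) ha
  -- A class modulo `𝔭^n` is a unit exactly when its image in the residue field is non-zero, so the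
  -- non-units form the kernel of this surjection, of order `q^{n-1}`.
  let g : (𝒪[F] ⧸ Ideal.span {ϖ} ^ n) →+* 𝓀[F] := Ideal.Quotient.lift _ _ hle
  have hg : Function.Surjective g :=
    Ideal.Quotient.lift_surjective_of_surjective _ hle IsLocalRing.residue_surjective
  have hker : Nat.card g.toAddMonoidHom.ker = residueCard F ^ (n - 1) := by
    have h1 := AddSubgroup.card_mul_index g.toAddMonoidHom.ker
    rw [AddSubgroup.index_ker, AddMonoidHom.range_eq_top (f := g.toAddMonoidHom) |>.2 hg,
      AddSubgroup.card_top, hcard] at h1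
    refine Nat.eq_of_mul_eq_mul_right hq (h1.trans ?_)
    rw [← pow_succ, Nat.sub_add_cancel hn]
  let s : (𝒪[F] ⧸ Ideal.span {ϖ} ^ n) → 𝒪[F] := Function.surjInv Ideal.Quotient.mk_surjective
  have hs : ∀ a, Ideal.Quotient.mk _ (s a) = a := Function.surjInv_eq _
  have hsub : ∀ x y : 𝒪[F], (x : F) - y ∈ primePow ϖ n ↔
      Ideal.Quotient.mk (Ideal.span {ϖ} ^ n) x = Ideal.Quotient.mk _ y := fun x y => by
    rw [Ideal.Quotient.mk_eq_mk_iff_sub_mem, ← coe_mem_primePow_iff]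
    rfl
  have hunit : ∀ x : 𝒪[F], g (Ideal.Quotient.mk _ x) ≠ 0 ↔ valuation F (x : F) = 1 := fun x => by
    rw [← isUnit_integer_iff, Ideal.Quotient.lift_mk]
    exact IsLocalRing.residue_ne_zero_iff_isUnit x
  refine ⟨(Finset.univ.filter (fun a => g a ≠ 0)).image (fun a => (s a : F)), ?_, ?_, ?_, ?_⟩
  · rw [Finset.card_image_of_injective]
    · have h1 := Finset.card_filter_add_card_filter_not (s := Finset.univ) (fun a => g a = 0)
      have h2 : (Finset.univ.filter (fun a => g a = 0)).card = Nat.card g.toAddMonoidHom.ker := by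
        rw [← Fintype.card_subtype, ← Nat.card_eq_fintype_card]
        rfl
      rw [Finset.card_univ, ← Nat.card_eq_fintype_card, hcard, h2, hker] at h1
      exact (Nat.sub_eq_of_eq_add' h1.symm).symm
    · intro a a' h
      rw [← hs a, ← hs a', Subtype.ext h]
  · simp only [Finset.mem_image, Finset.mem_filter, Finset.mem_univ, true_and]
    rintro _ ⟨a, ha, rfl⟩
    rwa [← hunit, hs]
  · simp only [Finset.mem_image, Finset.mem_filter, Finset.mem_univ, true_and]
    rintro _ ⟨a, -, rfl⟩ _ ⟨a', -, rfl⟩ h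
    rw [hsub, hs, hs] at h
    rw [h]
  · intro x hx
    refine ⟨s (Ideal.Quotient.mk _ ⟨x, hx.le⟩), Finset.mem_image_of_mem _ ?_, ?_⟩
    · simp only [Finset.mem_filter, Finset.mem_univ, true_and]
      exact (hunit _).2 hx
    · exact (hsub ⟨x, hx.le⟩ _).2 (hs _).symm

end LocalField

/-! ### Integral matrices, congruence subgroups and the characters `θ_τ` -/

section Matrices

set_option linter.unusedSectionVars false

variable {F : Type*} [Field F] [ValuativeRel F] [TopologicalSpace F]

/-- The lattice `Mat₂(𝔭 ^ n)`. -/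
def primePowMat (ϖ : 𝒪[F]) (n : ℤ) : Set (Matrix (Fin 2) (Fin 2) F) :=
  {X | ∀ i j, X i j ∈ primePow ϖ n}

theorem mem_congruenceGroup_iff {ϖ : 𝒪[F]} {r : ℕ} {k : GL (Fin 2) F} :
    k ∈ congruenceGroup ϖ r ↔ (k : Matrix (Fin 2) (Fin 2) F) - 1 ∈ primePowMat ϖ r :=
  Iff.rfl

theorem primePowMat_mul_mem {ϖ : 𝒪[F]} (hϖ : Irreducible ϖ) {m n k : ℤ}
    {X Y : Matrix (Fin 2) (Fin 2) F} (hX : X ∈ primePowMat ϖ m) (hY : Y ∈ primePowMat ϖ n)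
    (hk : m + n = k) : X * Y ∈ primePowMat ϖ k := fun i j => by
  rw [Matrix.mul_apply, Fin.sum_univ_two]
  exact primePow_add_mem hϖ (primePow_mul_mem hϖ (hX _ _) (hY _ _) hk)
    (primePow_mul_mem hϖ (hX _ _) (hY _ _) hk)

theorem primePowMat_add_mem {ϖ : 𝒪[F]} (hϖ : Irreducible ϖ) {n : ℤ}
    {X Y : Matrix (Fin 2) (Fin 2) F} (hX : X ∈ primePowMat ϖ n) (hY : Y ∈ primePowMat ϖ n) :
    X + Y ∈ primePowMat ϖ n := fun i j => primePow_add_mem hϖ (hX i j) (hY i j)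

theorem primePowMat_neg_mem {ϖ : 𝒪[F]} (hϖ : Irreducible ϖ) {n : ℤ}
    {X : Matrix (Fin 2) (Fin 2) F} (hX : X ∈ primePowMat ϖ n) :
    -X ∈ primePowMat ϖ n := fun i j => primePow_neg_mem hϖ (hX i j)

theorem primePowMat_mono {ϖ : 𝒪[F]} (hϖ : Irreducible ϖ) {m n : ℤ} (h : m ≤ n) :
    primePowMat ϖ n ⊆ primePowMat ϖ m := fun _ hX i j => primePow_mono hϖ h (hX i j)

theorem trace_mem_primePow {ϖ : 𝒪[F]} (hϖ : Irreducible ϖ) {n : ℤ}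
    {X : Matrix (Fin 2) (Fin 2) F} (hX : X ∈ primePowMat ϖ n) : X.trace ∈ primePow ϖ n := by
  rw [Matrix.trace_fin_two]
  exact primePow_add_mem hϖ (hX _ _) (hX _ _)

theorem coe_inv_mul_coe (g : GL (Fin 2) F) :
    ((g⁻¹ : GL (Fin 2) F) : Matrix (Fin 2) (Fin 2) F) * (g : Matrix (Fin 2) (Fin 2) F) = 1 :=
  Units.inv_mul g

theorem coe_mul_coe_inv (g : GL (Fin 2) F) :
    (g : Matrix (Fin 2) (Fin 2) F) * ((g⁻¹ : GL (Fin 2) F) : Matrix (Fin 2) (Fin 2) F) = 1 :=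
  Units.mul_inv g

theorem coe_inv_eq (g : GL (Fin 2) F) : ((g⁻¹ : GL (Fin 2) F) : Matrix (Fin 2) (Fin 2) F) =
    (g : Matrix (Fin 2) (Fin 2) F).det⁻¹ • !![g 1 1, -g 0 1; -g 1 0, g 0 0] := by
  rw [Matrix.coe_units_inv, Matrix.inv_def, Ring.inverse_eq_inv', Matrix.adjugate_fin_two]

variable (F) in
/-- The maximal compact subgroup `GL₂(𝒪)` of `GL₂(F)`. -/
def integralGL : Subgroup (GL (Fin 2) F) where
  carrier := {g | (∀ i j, valuation F (g i j) ≤ 1) ∧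
    valuation F (g : Matrix (Fin 2) (Fin 2) F).det = 1}
  mul_mem' := by
    rintro g h ⟨hg, hg'⟩ ⟨hh, hh'⟩
    refine ⟨fun i j => ?_, ?_⟩
    · rw [Matrix.GeneralLinearGroup.coe_mul, Matrix.mul_apply, Fin.sum_univ_two]
      refine Valuation.map_add_le _ ?_ ?_ <;> rw [map_mul] <;> exact mul_le_one' (hg _ _) (hh _ _)
    · rw [Matrix.GeneralLinearGroup.coe_mul, Matrix.det_mul, map_mul, hg', hh', one_mul]
  one_mem' := ⟨fun i j => by fin_cases i <;> fin_cases j <;> simp, by simp⟩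
  inv_mem' := by
    rintro g ⟨hg, hg'⟩
    have h := coe_inv_eq g
    refine ⟨fun i j => ?_, ?_⟩
    · rw [h]
      fin_cases i <;> fin_cases j <;> simp [hg', hg]
    · have h1 := congrArg (fun X => valuation F X.det) (coe_mul_coe_inv g)
      simpa only [Matrix.det_mul, map_mul, hg', one_mul, Matrix.det_one, map_one] using h1

theorem integralGL_mem_primePowMat {ϖ : 𝒪[F]} (hϖ : Irreducible ϖ) {g : GL (Fin 2) F}
    (hg : g ∈ integralGL F) : (g : Matrix (Fin 2) (Fin 2) F) ∈ primePowMat ϖ 0 :=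
  fun i j => (mem_primePow_zero_iff hϖ).2 (hg.1 i j)

theorem congruenceGroup_subset_integralGL {ϖ : 𝒪[F]} (hϖ : Irreducible ϖ) {r : ℕ} (hr : 1 ≤ r) :
    congruenceGroup ϖ r ⊆ integralGL F := by
  intro k hk
  have h1 : ∀ i j, valuation F (k i j) ≤ 1 := fun i j => by
    rw [← mem_primePow_zero_iff hϖ, ← sub_add_cancel (k i j) ((1 : Matrix (Fin 2) (Fin 2) F) i j)]
    refine primePow_add_mem hϖ (primePow_mono hϖ (by omega) (hk i j)) ?_
    rw [mem_primePow_zero_iff hϖ]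
    fin_cases i <;> fin_cases j <;> simp
  refine ⟨h1, valuation_eq_one_of_sub_mem hϖ (n := r) (y := 1) (by omega) ?_ (map_one _)⟩
  have h00 : k 0 0 - 1 ∈ primePow ϖ r := by simpa using hk 0 0
  have h01 : k 0 1 ∈ primePow ϖ r := by simpa using hk 0 1
  have h11 : k 1 1 - 1 ∈ primePow ϖ r := by simpa using hk 1 1
  have he : (k : Matrix (Fin 2) (Fin 2) F).det - 1 =
      (k 0 0 - 1) * k 1 1 + (k 1 1 - 1) - k 0 1 * k 1 0 := by
    rw [Matrix.det_fin_two]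
    ring
  rw [he]
  exact primePow_sub_mem hϖ (primePow_add_mem hϖ (primePow_mul_integer hϖ h00 (h1 _ _)) h11)
    (primePow_mul_integer hϖ h01 (h1 _ _))

/-- The principal congruence subgroup `K(r)`, `r ≥ 1`, as a subgroup of `GL₂(F)`. -/
def congruenceSubgroup {ϖ : 𝒪[F]} (hϖ : Irreducible ϖ) {r : ℕ} (hr : 1 ≤ r) :
    Subgroup (GL (Fin 2) F) where
  carrier := congruenceGroup ϖ r
  one_mem' := fun i j => by simpa using primePow_zero_mem hϖ r
  mul_mem' := by
    intro k l hk hl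
    rw [mem_congruenceGroup_iff] at *
    have he : ((k * l : GL (Fin 2) F) : Matrix (Fin 2) (Fin 2) F) - 1 =
        ((k : Matrix (Fin 2) (Fin 2) F) - 1) * (l - 1) + (k - 1) + (l - 1) := by
      rw [Matrix.GeneralLinearGroup.coe_mul]
      noncomm_ring
    rw [he]
    exact primePowMat_add_mem hϖ (primePowMat_add_mem hϖ (primePowMat_mono hϖ (by omega)
      (primePowMat_mul_mem hϖ hk hl rfl)) hk) hl
  inv_mem' := by
    intro k hk
    have hk' := integralGL_mem_primePowMat hϖ
      (inv_mem (congruenceGroup_subset_integralGL hϖ hr hk))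
    simp only [mem_congruenceGroup_iff] at *
    have he : ((k⁻¹ : GL (Fin 2) F) : Matrix (Fin 2) (Fin 2) F) - 1 =
        -(((k⁻¹ : GL (Fin 2) F) : Matrix (Fin 2) (Fin 2) F) * (k - 1)) := by
      rw [mul_sub, coe_inv_mul_coe, mul_one, neg_sub]
    rw [he]
    exact primePowMat_neg_mem hϖ (primePowMat_mul_mem hϖ hk' hk (zero_add _))

theorem conj_mem_congruenceGroup {ϖ : 𝒪[F]} (hϖ : Irreducible ϖ) {r : ℕ} {g k : GL (Fin 2) F}
    (hg : g ∈ integralGL F) (hk : k ∈ congruenceGroup ϖ r) :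
    g * k * g⁻¹ ∈ congruenceGroup ϖ r := by
  rw [mem_congruenceGroup_iff] at *
  have he : ((g * k * g⁻¹ : GL (Fin 2) F) : Matrix (Fin 2) (Fin 2) F) - 1 =
      g * ((k : Matrix (Fin 2) (Fin 2) F) - 1) * (g⁻¹ : GL (Fin 2) F) := by
    rw [mul_sub, sub_mul, mul_one, coe_mul_coe_inv]
    rfl
  rw [he]
  exact primePowMat_mul_mem hϖ (primePowMat_mul_mem hϖ (integralGL_mem_primePowMat hϖ hg) hk
    (zero_add _)) (integralGL_mem_primePowMat hϖ (inv_mem hg)) (add_zero _)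

theorem isUnramifiedChar_apply_eq_one {ψ : AddChar F Circle} (hψ : IsUnramifiedChar ψ)
    {ϖ : 𝒪[F]} (hϖ : Irreducible ϖ) {x : F} (hx : x ∈ primePow ϖ 0) : ψ x = 1 := by
  rw [mem_primePow_zero_iff hϖ] at hx
  simpa using (hψ.2 x).2 hx 1

theorem thetaChar_one (ψ : AddChar F Circle) (τ : Matrix (Fin 2) (Fin 2) F) :
    thetaChar ψ τ 1 = 1 := by
  simp [thetaChar]

/-- The defect of multiplicativity is `ψ(tr(τ(k - 1)(l - 1)))`, and `-2r + r + r = 0` makes its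
argument integral. -/
theorem thetaChar_mul {ψ : AddChar F Circle} (hψ : IsUnramifiedChar ψ)
    {ϖ : 𝒪[F]} (hϖ : Irreducible ϖ) {r : ℕ} {τ : Matrix (Fin 2) (Fin 2) F}
    (hτ : τ ∈ primePowMat ϖ (-(2 * r : ℤ))) {k l : GL (Fin 2) F}
    (hk : k ∈ congruenceGroup ϖ r) (hl : l ∈ congruenceGroup ϖ r) :
    thetaChar ψ τ (k * l) = thetaChar ψ τ k * thetaChar ψ τ l := by
  rw [mem_congruenceGroup_iff] at hk hl
  have he : τ * (((k * l : GL (Fin 2) F) : Matrix (Fin 2) (Fin 2) F) - 1) =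
      τ * (((k : Matrix (Fin 2) (Fin 2) F) - 1) * (l - 1)) + τ * (k - 1) + τ * (l - 1) := by
    rw [Matrix.GeneralLinearGroup.coe_mul]
    noncomm_ring
  rw [thetaChar, he, Matrix.trace_add, Matrix.trace_add, AddChar.map_add_eq_mul,
    AddChar.map_add_eq_mul, isUnramifiedChar_apply_eq_one hψ hϖ, one_mul]
  · rfl
  · exact trace_mem_primePow hϖ (primePowMat_mul_mem hϖ hτ (primePowMat_mul_mem hϖ hk hl rfl)
      (by ring))

theorem thetaChar_eq_one {ψ : AddChar F Circle} (hψ : IsUnramifiedChar ψ)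
    {ϖ : 𝒪[F]} (hϖ : Irreducible ϖ) {r : ℕ} {τ : Matrix (Fin 2) (Fin 2) F}
    (hτ : τ ∈ primePowMat ϖ (-(2 * r : ℤ))) {k : GL (Fin 2) F}
    (hk : k ∈ congruenceGroup ϖ (2 * r)) : thetaChar ψ τ k = 1 :=
  isUnramifiedChar_apply_eq_one hψ hϖ
    (trace_mem_primePow hϖ (primePowMat_mul_mem hϖ hτ hk (by push_cast; ring)))

/-- Invariance of the trace under conjugation. The relation between `τ` and `τ'` is stated without
an inverse so that it can be checked entrywise. -/
theorem thetaChar_conj (ψ : AddChar F Circle) {τ τ' : Matrix (Fin 2) (Fin 2) F}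
    {g : GL (Fin 2) F} (h : τ' * g = g * τ) (k : GL (Fin 2) F) :
    thetaChar ψ τ' (g * k * g⁻¹) = thetaChar ψ τ k := by
  have he : ((g * k * g⁻¹ : GL (Fin 2) F) : Matrix (Fin 2) (Fin 2) F) - 1 =
      g * (((k : Matrix (Fin 2) (Fin 2) F) - 1) * (g⁻¹ : GL (Fin 2) F)) := by
    rw [sub_mul, mul_sub, one_mul, coe_mul_coe_inv, ← mul_assoc]
    rfl
  rw [thetaChar, thetaChar, he, ← mul_assoc, h, mul_assoc, Matrix.trace_mul_comm,
    mul_assoc, mul_assoc, coe_inv_mul_coe, mul_one, Matrix.trace_mul_comm]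

theorem isOpen_congruenceGroup [IsNonarchimedeanLocalField F] {ϖ : 𝒪[F]} (hϖ : Irreducible ϖ)
    (r : ℕ) : IsOpen (congruenceGroup ϖ r) := by
  have h : congruenceGroup ϖ r = ⋂ i, ⋂ j, (fun g : GL (Fin 2) F =>
      g i j - (1 : Matrix (Fin 2) (Fin 2) F) i j) ⁻¹' primePow ϖ r := by
    ext g
    simp [congruenceGroup]
  rw [h]
  refine isOpen_iInter_of_finite fun i => isOpen_iInter_of_finite fun j => ?_
  refine (isOpen_primePow hϖ r).preimage ?_
  exact (Units.continuous_val.matrix_elem i j).sub continuous_const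

end Matrices

/-! ### The group `K_H(m, m)` and its slices -/

section Period

set_option linter.unusedSectionVars false

variable {F : Type*} [Field F] [ValuativeRel F] [TopologicalSpace F]

theorem heckeGroup_subset_integralGL {ϖ : 𝒪[F]} (hϖ : Irreducible ϖ) {m n : ℕ} :
    heckeGroup ϖ m n ⊆ integralGL F := by
  rintro k ⟨h00, h01, h10, h11, hdet⟩
  refine ⟨fun i j => ?_, hdet⟩
  fin_cases i <;> fin_cases j
  · exact h00
  · exact (mem_primePow_zero_iff hϖ).1 (primePow_mono hϖ (by omega) h01)
  · exact (mem_primePow_zero_iff hϖ).1 (primePow_mono hϖ (by omega) h10)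
  · exact h11

/-- The product of the off-diagonal entries lies in `𝔭^n`, so the product of the diagonal entries is
congruent to the unit determinant. -/
theorem heckeGroup_valuation_diag {ϖ : 𝒪[F]} (hϖ : Irreducible ϖ) {m n : ℕ} (hn : 1 ≤ n)
    {k : GL (Fin 2) F} (hk : k ∈ heckeGroup ϖ m n) :
    valuation F (k 0 0) = 1 ∧ valuation F (k 1 1) = 1 := by
  obtain ⟨h00, h01, h10, h11, hdet⟩ := hk
  have h10' : valuation F (k 1 0) ≤ 1 :=
    (mem_primePow_zero_iff hϖ).1 (primePow_mono hϖ (by omega) h10)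
  have h : valuation F (k 0 0 * k 1 1) = 1 := by
    refine valuation_eq_one_of_sub_mem hϖ (n := n) (by omega) ?_ hdet
    rw [Matrix.det_fin_two, sub_sub_cancel]
    exact primePow_mul_integer hϖ h01 h10'
  rw [map_mul] at h
  have h00' : valuation F (k 0 0) ≤ 1 := h00
  have h11' : valuation F (k 1 1) ≤ 1 := h11
  constructor
  · refine le_antisymm h00' ?_
    rw [← h]
    exact mul_le_of_le_one_right' h11'
  · refine le_antisymm h11' ?_
    rw [← h]
    exact mul_le_of_le_one_left' h00'

/-- The part of `K_H(m, m)` where the diagonal entries `a`, `d` satisfy `a ≡ t d` modulo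
`𝔭 ^ r`. -/
def heckeSlice (ϖ : 𝒪[F]) (m r : ℕ) (t : F) : Set (GL (Fin 2) F) :=
  {k | k ∈ heckeGroup ϖ m m ∧ k 0 0 - t * k 1 1 ∈ primePow ϖ r}

/-- The element `diag(a, 1)` of `GL₂(F)`. -/
noncomputable def diagUnit (a : F) (ha : a ≠ 0) : GL (Fin 2) F :=
  Matrix.GeneralLinearGroup.mkOfDetNeZero !![a, 0; 0, 1] (by simpa using ha)

theorem diagUnit_mul_mem_heckeSlice_iff {ϖ : 𝒪[F]} (hϖ : Irreducible ϖ) {m r : ℕ} {t : F}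
    (ht : valuation F t = 1) (ht0 : t ≠ 0) (k : GL (Fin 2) F) :
    diagUnit t ht0 * k ∈ heckeSlice ϖ m r t ↔ k ∈ heckeSlice ϖ m r 1 := by
  have h : ((diagUnit t ht0 * k : GL (Fin 2) F) : Matrix (Fin 2) (Fin 2) F) =
      !![t * k 0 0, t * k 0 1; k 1 0, k 1 1] := by
    ext i j
    fin_cases i <;> fin_cases j <;>
      simp [diagUnit, Matrix.GeneralLinearGroup.mkOfDetNeZero, Matrix.mul_apply]
  have hdet : (!![t * k 0 0, t * k 0 1; k 1 0, k 1 1]).det =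
      (k : Matrix (Fin 2) (Fin 2) F).det * t := by
    rw [Matrix.det_fin_two_of, Matrix.det_fin_two]
    ring
  simp only [heckeSlice, heckeGroup, Set.mem_ofPred_eq, h, hdet]
  simp only [Matrix.of_apply, Matrix.cons_val', Matrix.cons_val_zero, Matrix.cons_val_one,
    Matrix.cons_val_fin_one, map_mul, ht, mul_one, one_mul, Valuation.mem_integer_iff,
    mul_comm t, ← sub_mul, primePow_mul_unit_iff hϖ ht]

theorem t2Space_of_isNonarchimedeanLocalField [IsNonarchimedeanLocalField F] : T2Space F := by
  let := IsTopologicalAddGroup.rightUniformSpace F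
  have := isUniformAddGroup_of_addCommGroup (G := F)
  have := ValuedRing.separated (K := F) (Γ₀ := ValueGroupWithZero F)
  infer_instance

/-- The unit group carries the topology of the closed embedding `g ↦ (g, g⁻¹)`, under which `GL₂(𝒪)`
is the preimage of a product of two compact sets: an integral matrix has unit determinant exactly
when its inverse is integral too. -/
theorem isCompact_integralGL [IsNonarchimedeanLocalField F] :
    IsCompact (integralGL F : Set (GL (Fin 2) F)) := by
  have hO : IsCompact {x : F | valuation F x ≤ 1} :=
    IsNonarchimedeanLocalField.isCompact_closedBall F 1
  have hM : IsCompact {X : Matrix (Fin 2) (Fin 2) F | ∀ i j, valuation F (X i j) ≤ 1} := by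
    have h1 : IsCompact {f : Fin 2 → F | ∀ j, valuation F (f j) ≤ 1} := by
      simpa [Set.pi] using isCompact_univ_pi (X := fun _ : Fin 2 => F) fun _ => hO
    have h2 : IsCompact {f : Fin 2 → Fin 2 → F | ∀ i j, valuation F (f i j) ≤ 1} := by
      simpa [Set.pi] using isCompact_univ_pi (X := fun _ : Fin 2 => Fin 2 → F) fun _ => h1
    exact h2
  have : T2Space F := t2Space_of_isNonarchimedeanLocalField
  have : T1Space (Matrix (Fin 2) (Fin 2) F) := inferInstanceAs (T1Space (Fin 2 → Fin 2 → F))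
  have hP := hM.prod (hM.image MulOpposite.continuous_op)
  have h1 := (Units.isClosedEmbedding_embedProduct
    (α := Matrix (Fin 2) (Fin 2) F)).isCompact_preimage hP
  convert h1
  ext g
  constructor
  · intro hg
    exact ⟨hg.1, _, (inv_mem hg).1, rfl⟩
  · rintro ⟨hg, X, hX, hXg⟩
    have hX' : X = ((g⁻¹ : GL (Fin 2) F) : Matrix (Fin 2) (Fin 2) F) :=
      MulOpposite.op_injective hXg
    subst hX'
    have hle : ∀ Y : Matrix (Fin 2) (Fin 2) F, (∀ i j, valuation F (Y i j) ≤ 1) →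
        valuation F Y.det ≤ 1 := fun Y hY => by
      rw [Matrix.det_fin_two]
      refine (Valuation.map_sub _ _ _).trans (max_le ?_ ?_) <;> rw [map_mul] <;>
        exact mul_le_one' (hY _ _) (hY _ _)
    have h2 : valuation F (g : Matrix (Fin 2) (Fin 2) F).det *
        valuation F ((g⁻¹ : GL (Fin 2) F) : Matrix (Fin 2) (Fin 2) F).det = 1 := by
      rw [← map_mul, ← Matrix.det_mul, coe_mul_coe_inv, Matrix.det_one, map_one]
    refine ⟨hg, le_antisymm (hle _ hg) ?_⟩
    rw [← h2]
    exact mul_le_of_le_one_right' (hle _ hX)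

theorem isOpen_valuation_eq_one [IsNonarchimedeanLocalField F] {ϖ : 𝒪[F]} (hϖ : Irreducible ϖ) :
    IsOpen {x : F | valuation F x = 1} := by
  rw [isOpen_iff_mem_nhds]
  intro x hx
  have h : (fun y => y - x) ⁻¹' primePow ϖ 1 ∈ nhds x :=
    ((isOpen_primePow hϖ 1).preimage (continuous_id.sub continuous_const)).mem_nhds
      (by simpa using primePow_zero_mem hϖ 1)
  filter_upwards [h] with y hy
  exact valuation_eq_one_of_sub_mem hϖ le_rfl hy hx

theorem isOpen_heckeGroup [IsNonarchimedeanLocalField F] {ϖ : 𝒪[F]} (hϖ : Irreducible ϖ)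
    (m n : ℤ) : IsOpen (heckeGroup ϖ m n) := by
  have hc : ∀ i j, Continuous fun g : GL (Fin 2) F => g i j :=
    fun i j => Units.continuous_val.matrix_elem i j
  have hO : IsOpen ((𝒪[F] : Set F)) := by
    convert isOpen_primePow hϖ 0
    ext x
    exact (mem_primePow_zero_iff hϖ).symm
  refine (hO.preimage (hc 0 0)).inter (((isOpen_primePow hϖ n).preimage (hc 0 1)).inter
    (((isOpen_primePow hϖ m).preimage (hc 1 0)).inter ((hO.preimage (hc 1 1)).inter
    ((isOpen_valuation_eq_one hϖ).preimage (Continuous.matrix_det Units.continuous_val)))))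

theorem isOpen_heckeSlice [IsNonarchimedeanLocalField F] {ϖ : 𝒪[F]} (hϖ : Irreducible ϖ)
    (m r : ℕ) (t : F) : IsOpen (heckeSlice ϖ m r t) := by
  have hc : ∀ i j, Continuous fun g : GL (Fin 2) F => g i j :=
    fun i j => Units.continuous_val.matrix_elem i j
  exact (isOpen_heckeGroup hϖ m m).inter
    ((isOpen_primePow hϖ r).preimage ((hc 0 0).sub (continuous_const.mul (hc 1 1))))

/-! ### Volumes of the slices -/

section Measure

variable [IsNonarchimedeanLocalField F] [MeasurableSpace (GL (Fin 2) F)]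
  [BorelSpace (GL (Fin 2) F)] (μ : Measure (GL (Fin 2) F)) [μ.IsHaarMeasure]

theorem measure_heckeGroup_lt_top {ϖ : 𝒪[F]} (hϖ : Irreducible ϖ) (m : ℕ) :
    μ (heckeGroup ϖ m m) < ⊤ :=
  (measure_mono (heckeGroup_subset_integralGL hϖ)).trans_lt isCompact_integralGL.measure_lt_top

/-- Left translation by `diag(t, 1)` multiplies `a` by `t` and leaves `d` alone, and Haar measure is
left invariant. -/
theorem measure_heckeSlice {ϖ : 𝒪[F]} (hϖ : Irreducible ϖ) (m r : ℕ) {t : F}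
    (ht : valuation F t = 1) : μ (heckeSlice ϖ m r t) = μ (heckeSlice ϖ m r 1) := by
  have ht0 : t ≠ 0 := by
    rintro rfl
    simp at ht
  rw [← measure_preimage_mul μ (diagUnit t ht0) (heckeSlice ϖ m r t)]
  congr 1
  ext k
  exact diagUnit_mul_mem_heckeSlice_iff hϖ ht ht0 k

/-- The class of `a / d` in `(𝒪/𝔭^r)ˣ` partitions `K_H(m, m)` into slices of equal volume. -/
theorem measureReal_heckeGroup {ϖ : 𝒪[F]} (hϖ : Irreducible ϖ) {m r : ℕ} (hm : 1 ≤ m)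
    (hr : 1 ≤ r) : μ.real (heckeGroup ϖ m m) =
      ((residueCard F ^ r - residueCard F ^ (r - 1) : ℕ) : ℝ) * μ.real (heckeSlice ϖ m r 1) := by
  obtain ⟨T, hcard, hunit, hinj, hsurj⟩ := exists_unit_representatives hϖ hr
  have hU : heckeGroup ϖ m m = ⋃ t ∈ T, heckeSlice ϖ m r t := by
    ext k
    simp only [Set.mem_iUnion, exists_prop]
    constructor
    · intro hk
      obtain ⟨ha, hd⟩ := heckeGroup_valuation_diag hϖ hm hk
      have hd0 : k 1 1 ≠ 0 := fun h => by simp [h] at hd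
      obtain ⟨t, ht, h⟩ := hsurj (k 0 0 / k 1 1) (by rw [map_div₀, ha, hd, div_one])
      refine ⟨t, ht, hk, ?_⟩
      have := (primePow_mul_unit_iff hϖ hd).2 h
      rwa [sub_mul, div_mul_cancel₀ _ hd0] at this
    · rintro ⟨t, -, hk, -⟩
      exact hk
  have hdisj : (T : Set F).PairwiseDisjoint (heckeSlice ϖ m r) := by
    intro t ht t' ht' hne
    refine Set.disjoint_left.2 fun k hk hk' => hne ?_
    refine (hinj t' ht' t ht ((primePow_mul_unit_iff hϖ
      (heckeGroup_valuation_diag hϖ hm hk.1).2).1 ?_)).symm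
    convert primePow_sub_mem hϖ hk.2 hk'.2 using 1
    ring
  have hfin : ∀ t ∈ T, μ (heckeSlice ϖ m r t) ≠ ⊤ := fun t _ =>
    ((measure_mono fun _ hk => hk.1).trans_lt (measure_heckeGroup_lt_top μ hϖ m)).ne
  have h : μ (heckeGroup ϖ m m) = ∑ t ∈ T, μ (heckeSlice ϖ m r t) := by
    rw [hU, measure_biUnion_finset hdisj
      fun t _ => (isOpen_heckeSlice hϖ m r t).measurableSet]
  rw [Measure.real, h, Finset.sum_congr rfl fun t ht => measure_heckeSlice μ hϖ m r (hunit t ht),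
    Finset.sum_const, hcard, nsmul_eq_mul, ENNReal.toReal_mul, ENNReal.toReal_natCast]
  rfl

theorem measureReal_heckeSlice_pos {ϖ : 𝒪[F]} (hϖ : Irreducible ϖ) (m r : ℕ) :
    0 < μ.real (heckeSlice ϖ m r 1) := by
  refine ENNReal.toReal_pos ?_ ?_
  · refine ((isOpen_heckeSlice hϖ m r 1).measure_pos μ ⟨1, ?_⟩).ne'
    refine ⟨⟨?_, ?_, ?_, ?_, ?_⟩, ?_⟩ <;>
      simp [primePow_zero_mem hϖ, one_mem]
  · exact ((measure_mono fun _ hk => hk.1).trans_lt (measure_heckeGroup_lt_top μ hϖ m)).ne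

end Measure

theorem localZeta_one_mul (q r : ℕ) (hq : 1 < q) (hr : 1 ≤ r) :
    ((q ^ r - q ^ (r - 1) : ℕ) : ℂ)⁻¹ = localZeta q 1 * (q : ℂ) ^ (-(r : ℤ)) := by
  obtain ⟨s, rfl⟩ := Nat.exists_eq_add_of_le' hr
  have hq0 : (q : ℂ) ≠ 0 := by exact_mod_cast (by omega : q ≠ 0)
  have hq1 : (q : ℂ) - 1 ≠ 0 := sub_ne_zero.2 (by exact_mod_cast hq.ne')
  rw [localZeta, Nat.cast_sub (Nat.pow_le_pow_right (by omega) (by omega)), Complex.cpow_neg_one,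
    zpow_neg, zpow_natCast, ← mul_inv, Nat.add_sub_cancel]
  congr 1
  push_cast
  field_simp
  ring

end Period

/-! ### Matrix coefficients of localised vectors and the period -/

section Localised

set_option linter.unusedSectionVars false

variable {F : Type*} [Field F] [ValuativeRel F] [TopologicalSpace F]
variable {V : Type*} [NormedAddCommGroup V] [InnerProductSpace ℂ V]

/-- The vector `v` transforms under `K(r)` by `θ_τ`. -/
def IsLocalisedAt (ψ : AddChar F Circle) (ϖ : 𝒪[F]) (r : ℕ) (τ : Matrix (Fin 2) (Fin 2) F)
    (π : Representation ℂ (GL (Fin 2) F) V) (v : V) : Prop :=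
  ∀ k ∈ congruenceGroup ϖ r, π k v = (thetaChar ψ τ k : ℂ) • v

theorem rep_mul_apply (π : Representation ℂ (GL (Fin 2) F) V) (g h : GL (Fin 2) F) (v : V) :
    π (g * h) v = π g (π h v) := by
  rw [map_mul]
  rfl

theorem coe_scalar_mul (u : Fˣ) (g : GL (Fin 2) F) :
    ((Matrix.GeneralLinearGroup.scalar (Fin 2) u * g : GL (Fin 2) F) :
      Matrix (Fin 2) (Fin 2) F) = (u : F) • (g : Matrix (Fin 2) (Fin 2) F) := by
  ext i j
  simp

/-- `K(r)` is normalised by `GL₂(𝒪)`, so moving `k` past `g` stays in `K(r)` and only conjugates the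
parameter. -/
theorem IsLocalisedAt.translate {ψ : AddChar F Circle} {ϖ : 𝒪[F]} (hϖ : Irreducible ϖ) {r : ℕ}
    {τ τ' : Matrix (Fin 2) (Fin 2) F} {π : Representation ℂ (GL (Fin 2) F) V} {v : V}
    (hv : IsLocalisedAt ψ ϖ r τ π v) {g : GL (Fin 2) F} (hg : g ∈ integralGL F)
    (h : τ' * g = g * τ) : IsLocalisedAt ψ ϖ r τ' π (π g v) := by
  intro k hk
  have hk' : g⁻¹ * k * g ∈ congruenceGroup ϖ r := by
    simpa using conj_mem_congruenceGroup hϖ (inv_mem hg) hk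
  have he : k * g = g * (g⁻¹ * k * g) := by group
  rw [← rep_mul_apply, he, rep_mul_apply, hv _ hk', map_smul, ← thetaChar_conj ψ h]
  congr 4
  group

/-- The matrix coefficient of a localised vector vanishes on elements of `GL₂(𝒪)` that do not
stabilise the character `θ_τ`. -/
theorem IsLocalisedAt.inner_eq_zero {ψ : AddChar F Circle} {ϖ : 𝒪[F]} (hϖ : Irreducible ϖ) {r : ℕ}
    {τ : Matrix (Fin 2) (Fin 2) F} {π : Representation ℂ (GL (Fin 2) F) V}
    (hπ : IsSmoothUnitaryIrrep π) {v : V} (hv : IsLocalisedAt ψ ϖ r τ π v) {k h : GL (Fin 2) F}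
    (hk : k ∈ integralGL F) (hh : h ∈ congruenceGroup ϖ r)
    (hne : thetaChar ψ τ (k⁻¹ * h * k) ≠ thetaChar ψ τ h) : inner ℂ v (π k v) = 0 := by
  have hh' : k⁻¹ * h * k ∈ congruenceGroup ϖ r := by
    simpa using conj_mem_congruenceGroup hϖ (inv_mem hk) hh
  have he : h * k = k * (k⁻¹ * h * k) := by group
  -- Applying `h` to both arguments multiplies the coefficient by `θ_τ(k⁻¹hk)` times the conjugate
  -- of `θ_τ(h)`, a factor different from `1`.
  have h1 := hπ.unitary h v (π k v)
  rw [← rep_mul_apply, he, rep_mul_apply, hv _ hh', hv _ hh, map_smul, inner_smul_left,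
    inner_smul_right, ← mul_assoc] at h1
  by_contra h0
  have h2 := (mul_eq_right₀ h0).1 h1
  rw [← Circle.coe_inv_eq_conj, ← Circle.coe_mul, Circle.coe_eq_one, inv_mul_eq_one] at h2
  exact hne h2.symm

/-- The lower triangular unipotent element with entry `y`. -/
def lowerUnipotent (y : F) : GL (Fin 2) F where
  val := !![1, 0; y, 1]
  inv := !![1, 0; -y, 1]
  val_inv := by simp [Matrix.one_fin_two]
  inv_val := by simp [Matrix.one_fin_two]

theorem lowerUnipotent_mem {ϖ : 𝒪[F]} (hϖ : Irreducible ϖ) {r : ℕ} {y : F}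
    (hy : y ∈ primePow ϖ r) : lowerUnipotent y ∈ congruenceGroup ϖ r := by
  intro i j
  fin_cases i <;> fin_cases j <;> simp [lowerUnipotent, primePow_zero_mem hϖ, hy]

/-- The parameters `τ` for which the period can be computed: `ϖ ^ (2 r) τ` is integral, its
diagonal is divisible by `ϖ ^ r`, and its upper right entry is a unit. -/
structure IsAntidiagonalParameter (ϖ : 𝒪[F]) (r : ℕ) (τ : Matrix (Fin 2) (Fin 2) F) : Prop where
  mem : τ ∈ primePowMat ϖ (-(2 * r : ℤ))
  diag₀ : τ 0 0 ∈ primePow ϖ (-(r : ℤ))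
  diag₁ : τ 1 1 ∈ primePow ϖ (-(r : ℤ))
  valuation_offDiag : valuation F (τ 0 1) = valuation F (ϖ : F) ^ (-(2 * r : ℤ))

/-- Lower unipotents with entry `y` detect the upper right entry of the parameter: up to integral
terms the two arguments of `ψ` differ by `τ₀₁ a(d - a) y / det k`. As `τ₀₁` has valuation exactly
`-2r`, this is integral for all `y ∈ 𝔭^r` only if `a ≡ d` modulo `𝔭^r`. -/
theorem IsAntidiagonalParameter.exists_thetaChar_ne {ψ : AddChar F Circle}
    (hψ : IsUnramifiedChar ψ) {ϖ : 𝒪[F]} (hϖ : Irreducible ϖ) {r : ℕ} (hr : 1 ≤ r)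
    {τ : Matrix (Fin 2) (Fin 2) F} (hτ : IsAntidiagonalParameter ϖ r τ) {k : GL (Fin 2) F}
    (hk : k ∈ heckeGroup ϖ (2 * r : ℕ) (2 * r : ℕ)) (hk' : k ∉ heckeSlice ϖ (2 * r) r 1) :
    ∃ h ∈ congruenceGroup ϖ r, thetaChar ψ τ (k⁻¹ * h * k) ≠ thetaChar ψ τ h := by
  obtain ⟨ha, hd⟩ := heckeGroup_valuation_diag hϖ (by omega) hk
  have hint := heckeGroup_subset_integralGL hϖ hk
  have hne : k 0 0 - k 1 1 ∉ primePow ϖ r := fun h => hk' ⟨hk, by rwa [one_mul]⟩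
  have hb := hk.2.1
  push_cast at hb
  have hΔ := hint.2
  set Δ := (k : Matrix (Fin 2) (Fin 2) F).det with hΔdef
  have hΔ0 : Δ ≠ 0 := fun h => by simp [h] at hΔ
  have hΔi : valuation F Δ⁻¹ = 1 := by rw [map_inv₀, hΔ, inv_one]
  -- the character `y ↦ θ_τ(h) / θ_τ(k⁻¹ h k)`, `h` lower unipotent
  set x := τ 0 1 * (k 0 0 * (k 1 1 - k 0 0)) * Δ⁻¹ with hx
  -- Were `ψ` trivial on `x 𝔭^r`, then `x ϖ^r` would be integral since `ψ` is unramified, which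
  -- forces `a - d ∈ 𝔭^r`.
  obtain ⟨z, hz⟩ : ∃ z : 𝒪[F], ψ (x * (ϖ : F) ^ (r : ℤ) * z) ≠ 1 := by
    by_contra! h
    have h1 : valuation F (x * (ϖ : F) ^ (r : ℤ)) ≤ 1 := (hψ.2 _).1 h
    apply hne
    have h0 := valuation_uniformizer_ne_zero hϖ
    rw [hx, map_mul, map_mul, map_mul, map_mul, hΔi, ha, hτ.valuation_offDiag,
      Valuation.map_sub_swap, mul_one, one_mul, map_zpow₀, mul_right_comm, ← zpow_add₀ h0] at h1
    rw [mem_primePow_iff hϖ, ← mul_le_mul_iff_right₀ (zpow_pos (zero_lt_iff.2 h0) (-(2 * r : ℤ) + r)),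
      ← zpow_add₀ h0]
    rw [show (-(2 * r : ℤ) + r + r) = 0 by ring, zpow_zero]
    exact h1
  set y := (ϖ : F) ^ (r : ℤ) * z with hy
  have hyr : y ∈ primePow ϖ r := ⟨z, rfl⟩
  have hyi : valuation F y ≤ 1 := (mem_primePow_zero_iff hϖ).1 (primePow_mono hϖ (by omega) hyr)
  refine ⟨lowerUnipotent y, lowerUnipotent_mem hϖ hyr, fun heq => hz ?_⟩
  have ht1 : (τ * (((lowerUnipotent y : GL (Fin 2) F) : Matrix (Fin 2) (Fin 2) F) - 1)).trace =
      τ 0 1 * y := by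
    simp [lowerUnipotent, Matrix.trace_fin_two, Matrix.mul_apply]
  have hlow : ((lowerUnipotent y : GL (Fin 2) F) : Matrix (Fin 2) (Fin 2) F) - 1 =
      !![0, 0; y, 0] := by
    ext i j
    fin_cases i <;> fin_cases j <;> simp [lowerUnipotent]
  have hconj : ((k⁻¹ * lowerUnipotent y * k : GL (Fin 2) F) : Matrix (Fin 2) (Fin 2) F) - 1 =
      (k⁻¹ : GL (Fin 2) F) * (((lowerUnipotent y : GL (Fin 2) F) :
        Matrix (Fin 2) (Fin 2) F) - 1) * k := by
    rw [mul_sub, sub_mul, mul_one, coe_inv_mul_coe]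
    rfl
  have ht2 : (τ * (((k⁻¹ * lowerUnipotent y * k : GL (Fin 2) F) :
      Matrix (Fin 2) (Fin 2) F) - 1)).trace =
      (τ 0 1 * k 0 0 ^ 2 - τ 0 0 * k 0 1 * k 0 0 - τ 1 0 * k 0 1 * k 0 1
        + τ 1 1 * k 0 1 * k 0 0) * y * Δ⁻¹ := by
    rw [hconj, coe_inv_eq, hlow, ← hΔdef]
    simp only [Matrix.trace_fin_two, Matrix.mul_apply, Fin.sum_univ_two, Matrix.smul_apply,
      Matrix.of_apply, Matrix.cons_val', Matrix.cons_val_zero, Matrix.cons_val_one,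
      Matrix.cons_val_fin_one, smul_eq_mul]
    ring
  have hdet : Δ = k 0 0 * k 1 1 - k 0 1 * k 1 0 := Matrix.det_fin_two _
  -- Each leftover term contains an entry of `τ` times `k 0 1`, which is integral because `k 0 1 ∈
  -- 𝔭^{2r}`.
  have hrem : τ 0 1 * y - (τ 0 1 * k 0 0 ^ 2 - τ 0 0 * k 0 1 * k 0 0 - τ 1 0 * k 0 1 * k 0 1
        + τ 1 1 * k 0 1 * k 0 0) * y * Δ⁻¹ - x * (ϖ : F) ^ (r : ℤ) * z ∈ primePow ϖ 0 := by
    have he : τ 0 1 * y - (τ 0 1 * k 0 0 ^ 2 - τ 0 0 * k 0 1 * k 0 0 - τ 1 0 * k 0 1 * k 0 1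
        + τ 1 1 * k 0 1 * k 0 0) * y * Δ⁻¹ - x * (ϖ : F) ^ (r : ℤ) * z =
        (τ 0 0 * k 0 1 * k 0 0 + τ 1 0 * k 0 1 * k 0 1 - τ 1 1 * k 0 1 * k 0 0
          - τ 0 1 * k 0 1 * k 1 0) * y * Δ⁻¹ := by
      have : τ 0 1 * y = τ 0 1 * y * (k 0 0 * k 1 1 - k 0 1 * k 1 0) * Δ⁻¹ := by
        rw [← hdet, mul_inv_cancel_right₀ hΔ0]
      rw [this, hx, hy]
      ring
    have hmem : ∀ i j, τ i j * k 0 1 ∈ primePow ϖ 0 := fun i j =>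
      primePow_mul_mem hϖ (hτ.mem i j) hb (by ring)
    rw [he]
    refine primePow_mul_integer hϖ (primePow_mul_integer hϖ ?_ hyi) hΔi.le
    exact primePow_sub_mem hϖ (primePow_sub_mem hϖ (primePow_add_mem hϖ
      (primePow_mul_integer hϖ (hmem _ _) (hint.1 _ _))
      (primePow_mul_integer hϖ (hmem _ _) (hint.1 _ _)))
      (primePow_mul_integer hϖ (hmem _ _) (hint.1 _ _)))
      (primePow_mul_integer hϖ (hmem _ _) (hint.1 _ _))
  have h1 := isUnramifiedChar_apply_eq_one hψ hϖ hrem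
  rw [thetaChar, thetaChar, ht1, ht2] at heq
  rw [AddChar.map_sub_eq_div, AddChar.map_sub_eq_div, heq, div_self', one_div, inv_eq_one] at h1
  exact h1

/-- Dividing `k` by its lower right entry, a scalar that acts trivially, gives an element of `K(r)`.
There the diagonal contributes `𝔭^{-r} 𝔭^r` to the trace and the off-diagonal entries `𝔭^{-2r}
𝔭^{2r}`, so `θ_τ` is trivial. -/
theorem IsLocalisedAt.inner_of_mem_heckeSlice {ψ : AddChar F Circle}
    (hψ : IsUnramifiedChar ψ) {ϖ : 𝒪[F]} (hϖ : Irreducible ϖ) {r : ℕ} (hr : 1 ≤ r)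
    {τ : Matrix (Fin 2) (Fin 2) F} (hτ : IsAntidiagonalParameter ϖ r τ)
    {π : Representation ℂ (GL (Fin 2) F) V} (hπ : IsSmoothUnitaryIrrep π) {v : V}
    (hv : IsLocalisedAt ψ ϖ r τ π v) {k : GL (Fin 2) F} (hk : k ∈ heckeSlice ϖ (2 * r) r 1) :
    π k v = v := by
  obtain ⟨hk, hkr⟩ := hk
  obtain ⟨ha, hd⟩ := heckeGroup_valuation_diag hϖ (by omega) hk
  have hd0 : k 1 1 ≠ 0 := fun h => by simp [h] at hd
  have hdi : valuation F (k 1 1)⁻¹ = 1 := by rw [map_inv₀, hd, inv_one]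
  rw [one_mul] at hkr
  have hb := hk.2.1
  have hc := hk.2.2.1
  push_cast at hb hc
  set z : Fˣ := Units.mk0 (k 1 1) hd0 with hz
  set k' : GL (Fin 2) F := Matrix.GeneralLinearGroup.scalar (Fin 2) z⁻¹ * k with hk'
  have hk1 : k = Matrix.GeneralLinearGroup.scalar (Fin 2) z * k' := by
    rw [hk', ← mul_assoc, ← map_mul, mul_inv_cancel, map_one, one_mul]
  have hcoe : (k' : Matrix (Fin 2) (Fin 2) F) - 1 =
      !![(k 0 0 - k 1 1) * (k 1 1)⁻¹, k 0 1 * (k 1 1)⁻¹; k 1 0 * (k 1 1)⁻¹, 0] := by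
    rw [hk', coe_scalar_mul]
    ext i j
    fin_cases i <;> fin_cases j <;> simp [hz, hd0, sub_mul, mul_comm (k 1 1)⁻¹]
  have hmem : k' ∈ congruenceGroup ϖ r := by
    rw [mem_congruenceGroup_iff, hcoe]
    have hle : (r : ℤ) ≤ 2 * r := by omega
    intro i j
    fin_cases i <;> fin_cases j
    · exact primePow_mul_integer hϖ hkr hdi.le
    · exact primePow_mul_integer hϖ (primePow_mono hϖ hle hb) hdi.le
    · exact primePow_mul_integer hϖ (primePow_mono hϖ hle hc) hdi.le
    · exact primePow_zero_mem hϖ r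
  have hθ : thetaChar ψ τ k' = 1 := by
    refine isUnramifiedChar_apply_eq_one hψ hϖ ?_
    have : (τ * ((k' : Matrix (Fin 2) (Fin 2) F) - 1)).trace =
        (τ 0 0 * (k 0 0 - k 1 1) + τ 0 1 * k 1 0 + τ 1 0 * k 0 1) * (k 1 1)⁻¹ := by
      rw [hcoe]
      simp [Matrix.trace_fin_two, Matrix.mul_apply]
      ring
    rw [this]
    exact primePow_mul_integer hϖ (primePow_add_mem hϖ (primePow_add_mem hϖ
      (primePow_mul_mem hϖ hτ.diag₀ hkr (by ring))
      (primePow_mul_mem hϖ (hτ.mem _ _) hc (by ring)))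
      (primePow_mul_mem hϖ (hτ.mem _ _) hb (by ring))) hdi.le
  rw [hk1, rep_mul_apply, hv _ hmem, hθ, Circle.coe_one, one_smul, hπ.central]

variable [IsNonarchimedeanLocalField F] [MeasurableSpace (GL (Fin 2) F)]
  [BorelSpace (GL (Fin 2) F)] (μ : Measure (GL (Fin 2) F)) [μ.IsHaarMeasure]

/-- The local period of a normalised vector localised at an antidiagonal parameter. -/
theorem IsLocalisedAt.localPeriod_eq {ψ : AddChar F Circle}
    (hψ : IsUnramifiedChar ψ) {ϖ : 𝒪[F]} (hϖ : Irreducible ϖ) {r : ℕ} (hr : 1 ≤ r)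
    {τ : Matrix (Fin 2) (Fin 2) F} (hτ : IsAntidiagonalParameter ϖ r τ)
    {π : Representation ℂ (GL (Fin 2) F) V} (hπ : IsSmoothUnitaryIrrep π) {v : V} (hv0 : v ≠ 0)
    (hv : IsLocalisedAt ψ ϖ r τ π v) :
    localPeriod μ ϖ π (2 * r) (((‖v‖⁻¹ : ℝ) : ℂ) • v) =
      localZeta (residueCard F) 1 * (residueCard F : ℂ) ^ (-(r : ℤ)) := by
  have hn : (‖v‖ : ℂ) ≠ 0 := by exact_mod_cast norm_ne_zero_iff.2 hv0
  have hq : 1 < residueCard F := Finite.one_lt_card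
  have hmeas := (isOpen_heckeSlice hϖ (2 * r) r 1).measurableSet
  have hsub : heckeSlice ϖ (2 * r) r 1 ⊆ heckeGroup ϖ (2 * r : ℕ) (2 * r : ℕ) := fun _ h => h.1
  -- On `K_H(2r, 2r)` the normalised coefficient is the indicator function of the slice `a ≡ d`.
  have hint : ∀ k ∈ heckeGroup ϖ (2 * r : ℕ) (2 * r : ℕ),
      inner ℂ (((‖v‖⁻¹ : ℝ) : ℂ) • v) (π k (((‖v‖⁻¹ : ℝ) : ℂ) • v)) =
        (heckeSlice ϖ (2 * r) r 1).indicator (fun _ => (1 : ℂ)) k := by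
    intro k hk
    rw [map_smul, inner_smul_left, inner_smul_right]
    by_cases hkS : k ∈ heckeSlice ϖ (2 * r) r 1
    · rw [Set.indicator_of_mem hkS, hv.inner_of_mem_heckeSlice hψ hϖ hr hτ hπ hkS,
        inner_self_eq_norm_sq_to_K, Complex.conj_ofReal, Complex.ofReal_inv]
      simp only [Complex.coe_algebraMap]
      field_simp
    · obtain ⟨h, hh, hne⟩ := hτ.exists_thetaChar_ne hψ hϖ hr hk hkS
      rw [Set.indicator_of_notMem hkS,
        hv.inner_eq_zero hϖ hπ (heckeGroup_subset_integralGL hϖ hk) hh hne, mul_zero, mul_zero]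
  rw [localPeriod, setIntegral_congr_fun (isOpen_heckeGroup hϖ _ _).measurableSet hint,
    integral_indicator hmeas, Measure.restrict_restrict hmeas, Set.inter_eq_left.2 hsub,
    setIntegral_const, measureReal_heckeGroup μ hϖ (by omega) hr,
    ← localZeta_one_mul _ _ hq hr]
  have hpos : ((μ.real (heckeSlice ϖ (2 * r) r 1) : ℝ) : ℂ) ≠ 0 := by
    exact_mod_cast (measureReal_heckeSlice_pos μ hϖ (2 * r) r).ne'
  rw [Complex.ofReal_mul, mul_inv, mul_assoc, Complex.real_smul, mul_one, inv_mul_cancel₀ hpos,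
    mul_one, Complex.ofReal_natCast]

end Localised

/-! ### Gluing two compatible characters to a function on a product set -/

section Extension

variable {G P : Type*} [Group G] [Group P]

open Classical in
/-- Given characters `α` of `P` and `β` of `K ≤ G`, the function on `G` with `f(p k) = α(p) β(k)`
which vanishes outside `P K`. -/
noncomputable def extendChar (i : P →* G) (K : Subgroup G) (α : P → ℂ) (β : G → ℂ) (g : G) : ℂ :=
  if h : ∃ x : P × G, x.2 ∈ K ∧ g = i x.1 * x.2 then α h.choose.1 * β h.choose.2 else 0

theorem exists_of_extendChar_ne_zero {i : P →* G} {K : Subgroup G} {α : P → ℂ} {β : G → ℂ} {g : G}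
    (h : extendChar i K α β g ≠ 0) : ∃ p, ∃ k ∈ K, g = i p * k := by
  unfold extendChar at h
  split_ifs at h with h1
  · obtain ⟨x, hx⟩ := h1
    exact ⟨x.1, x.2, hx.1, hx.2⟩
  · exact absurd rfl h

/-- Characters `α` of `P` and `β` of `K` that agree on the intersection. -/
structure AreCompatibleChars (i : P →* G) (K : Subgroup G) (α : P → ℂ) (β : G → ℂ) : Prop where
  map_mul_left : ∀ p q, α (p * q) = α p * α q
  map_one_left : α 1 = 1
  map_mul_right : ∀ k ∈ K, ∀ l ∈ K, β (k * l) = β k * β l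
  map_one_right : β 1 = 1
  agree : ∀ p, i p ∈ K → α p = β (i p)

namespace AreCompatibleChars

variable {i : P →* G} {K : Subgroup G} {α : P → ℂ} {β : G → ℂ} (h : AreCompatibleChars i K α β)
include h

/-- Two factorisations of the same element differ by an element of `i(P) ∩ K`, where the characters
agree; hence the chosen factorisation does not matter. -/
theorem extendChar_apply (p : P) {k : G} (hk : k ∈ K) :
    extendChar i K α β (i p * k) = α p * β k := by
  have hex : ∃ x : P × G, x.2 ∈ K ∧ i p * k = i x.1 * x.2 := ⟨(p, k), hk, rfl⟩
  rw [extendChar, dif_pos hex]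
  obtain ⟨hl, he⟩ := hex.choose_spec
  generalize hex.choose = x at hl he
  obtain ⟨q, l⟩ := x
  dsimp only at hl he ⊢
  have h1 : i (q⁻¹ * p) = l * k⁻¹ := by
    rw [map_mul, map_inv, eq_mul_inv_iff_mul_eq, mul_assoc, he, inv_mul_cancel_left]
  have hlk : l * k⁻¹ ∈ K := mul_mem hl (inv_mem hk)
  have h2 := h.agree (q⁻¹ * p) (h1 ▸ hlk)
  have h3 := h.map_mul_right _ hlk _ hk
  rw [inv_mul_cancel_right] at h3
  rw [h3, ← h1, ← h2, ← mul_assoc, ← h.map_mul_left, mul_inv_cancel_left]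

theorem extendChar_one : extendChar i K α β 1 = 1 := by
  have := h.extendChar_apply 1 (one_mem K)
  rwa [map_one, one_mul, h.map_one_left, h.map_one_right, one_mul] at this

theorem extendChar_mul_left (p : P) (g : G) :
    extendChar i K α β (i p * g) = α p * extendChar i K α β g := by
  by_cases hg : ∃ q, ∃ k ∈ K, g = i q * k
  · obtain ⟨q, k, hk, rfl⟩ := hg
    rw [← mul_assoc, ← map_mul, h.extendChar_apply _ hk, h.extendChar_apply _ hk, h.map_mul_left,
      mul_assoc]
  · rw [not_ne_iff.1 (mt exists_of_extendChar_ne_zero hg), mul_zero]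
    refine not_ne_iff.1 (mt exists_of_extendChar_ne_zero ?_)
    rintro ⟨q, k, hk, he⟩
    refine hg ⟨p⁻¹ * q, k, hk, ?_⟩
    rw [map_mul, mul_assoc, ← he, map_inv, inv_mul_cancel_left]

theorem extendChar_mul_right (g : G) {k : G} (hk : k ∈ K) :
    extendChar i K α β (g * k) = extendChar i K α β g * β k := by
  by_cases hg : ∃ q, ∃ l ∈ K, g = i q * l
  · obtain ⟨q, l, hl, rfl⟩ := hg
    rw [mul_assoc, h.extendChar_apply _ (mul_mem hl hk), h.extendChar_apply _ hl,
      h.map_mul_right _ hl _ hk, mul_assoc]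
  · rw [not_ne_iff.1 (mt exists_of_extendChar_ne_zero hg), zero_mul]
    refine not_ne_iff.1 (mt exists_of_extendChar_ne_zero ?_)
    rintro ⟨q, l, hl, he⟩
    refine hg ⟨q, l * k⁻¹, mul_mem hl (inv_mem hk), ?_⟩
    rw [← mul_assoc, ← he, mul_inv_cancel_right]

/-- Makes the glued function an eigenfunction for right translation by those elements of `P` that
normalise `K` and fix `β`, beyond `K` itself. -/
theorem extendChar_mul_right_of_normalizes (g : G) {d : P}
    (hd : ∀ k ∈ K, (i d)⁻¹ * k * i d ∈ K ∧ β ((i d)⁻¹ * k * i d) = β k)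
    (hd' : ∀ k ∈ K, i d * k * (i d)⁻¹ ∈ K) :
    extendChar i K α β (g * i d) = extendChar i K α β g * α d := by
  by_cases hg : ∃ q, ∃ l ∈ K, g = i q * l
  · obtain ⟨q, l, hl, rfl⟩ := hg
    have he : i q * l * i d = i (q * d) * ((i d)⁻¹ * l * i d) := by
      rw [map_mul]
      group
    rw [he, h.extendChar_apply _ (hd l hl).1, h.extendChar_apply _ hl, (hd l hl).2,
      h.map_mul_left]
    ring
  · rw [not_ne_iff.1 (mt exists_of_extendChar_ne_zero hg), zero_mul]
    refine not_ne_iff.1 (mt exists_of_extendChar_ne_zero ?_)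
    rintro ⟨q, l, hl, he⟩
    refine hg ⟨q * d⁻¹, _, hd' l hl, ?_⟩
    rw [eq_mul_inv_of_mul_eq he, map_mul, map_inv]
    group

/-- Needed for compact induction, where left equivariance is also required under `K`; all of `P`
must then normalise `(K, β)`. -/
theorem extendChar_mul_left_of_normalized (g : G) {k : G} (hk : k ∈ K)
    (hP : ∀ d, ∀ k ∈ K, (i d)⁻¹ * k * i d ∈ K ∧ β ((i d)⁻¹ * k * i d) = β k) :
    extendChar i K α β (k * g) = β k * extendChar i K α β g := by
  by_cases hg : ∃ q, ∃ l ∈ K, g = i q * l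
  · obtain ⟨q, l, hl, rfl⟩ := hg
    obtain ⟨h1, h2⟩ := hP q k hk
    have he : k * (i q * l) = i q * ((i q)⁻¹ * k * i q * l) := by group
    rw [he, h.extendChar_apply _ (mul_mem h1 hl), h.extendChar_apply _ hl,
      h.map_mul_right _ h1 _ hl, h2]
    ring
  · rw [not_ne_iff.1 (mt exists_of_extendChar_ne_zero hg), mul_zero]
    refine not_ne_iff.1 (mt exists_of_extendChar_ne_zero ?_)
    rintro ⟨q, l, hl, he⟩
    refine hg ⟨q, _, mul_mem (hP q k⁻¹ (inv_mem hk)).1 hl, ?_⟩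
    rw [eq_inv_mul_of_mul_eq he]
    group

end AreCompatibleChars

end Extension

/-! ### From eigenfunctions to eigenvectors -/

section Realisation

set_option linter.unusedSectionVars false

variable {F : Type*} [Field F] [ValuativeRel F] [TopologicalSpace F]
variable {V : Type*} [NormedAddCommGroup V] [InnerProductSpace ℂ V]

/-- One vector serves all pairs `(g, c)`, so every eigenvalue relation of `f` transfers at once. -/
theorem IsRealisedOn.exists_vector {π : Representation ℂ (GL (Fin 2) F) V}
    {W : Submodule ℂ (GL (Fin 2) F → ℂ)} (h : IsRealisedOn π W) {f : GL (Fin 2) F → ℂ}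
    (hf : f ∈ W) (hf0 : f ≠ 0) :
    ∃ v : V, v ≠ 0 ∧ ∀ (g : GL (Fin 2) F) (c : ℂ), (∀ x, f (x * g) = c * f x) → π g v = c • v := by
  obtain ⟨Φ, hΦ⟩ := h
  have hΦf : Φ (Φ.symm ⟨f, hf⟩) = ⟨f, hf⟩ := Φ.apply_symm_apply _
  refine ⟨Φ.symm ⟨f, hf⟩, ?_, fun g c hgc => Φ.injective (Subtype.ext (funext fun x => ?_))⟩
  · rw [Ne, LinearEquiv.map_eq_zero_iff, Submodule.mk_eq_zero]
    exact hf0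
  · rw [hΦ, map_smul, hΦf]
    exact hgc x

theorem isRightSmooth_of_thetaChar [IsNonarchimedeanLocalField F] {ψ : AddChar F Circle}
    (hψ : IsUnramifiedChar ψ) {ϖ : 𝒪[F]} (hϖ : Irreducible ϖ) {r : ℕ} (hr : 1 ≤ r)
    {τ : Matrix (Fin 2) (Fin 2) F} (hτ : τ ∈ primePowMat ϖ (-(2 * r : ℤ)))
    {f : GL (Fin 2) F → ℂ}
    (hf : ∀ g, ∀ k ∈ congruenceGroup ϖ r, f (g * k) = f g * (thetaChar ψ τ k : ℂ)) :
    IsRightSmooth f := by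
  refine ⟨congruenceSubgroup hϖ (r := 2 * r) (by omega), isOpen_congruenceGroup hϖ (2 * r),
    fun u hu g => ?_⟩
  have hu' : u ∈ congruenceGroup ϖ r := fun i j => primePow_mono hϖ (by omega) (hu i j)
  rw [hf g u hu', thetaChar_eq_one hψ hϖ hτ hu, Circle.coe_one, mul_one]

end Realisation

/-! ### Minimal vectors of supercuspidal representations -/

section Supercuspidal

set_option linter.unusedSectionVars false

variable {F : Type*} [Field F] [ValuativeRel F] [TopologicalSpace F]

theorem scalar_mul_comm (s : Fˣ) (g : GL (Fin 2) F) :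
    Matrix.GeneralLinearGroup.scalar (Fin 2) s * g =
      g * Matrix.GeneralLinearGroup.scalar (Fin 2) s := by
  ext i j
  simp [mul_comm]

theorem trace_quadMatrix_mul {D : F} (z w : QuadraticAlgebra F D 0) :
    (quadMatrix D z * (quadMatrix D w - 1)).trace = QuadraticAlgebra.trace (z * (w - 1)) := by
  rw [QuadraticAlgebra.trace_def, Matrix.trace_fin_two]
  simp [quadMatrix, Matrix.mul_apply, QuadraticAlgebra.re_one, QuadraticAlgebra.im_one]
  ring

theorem primePowE_of_quadEmb_mem {ϖ : 𝒪[F]} {r : ℕ} {D : F} {x : (QuadraticAlgebra F D 0)ˣ}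
    (hx : quadEmb D x ∈ congruenceGroup ϖ r) :
    (x : QuadraticAlgebra F D 0) - 1 ∈ primePowE ϖ D r := by
  constructor
  · simpa [quadEmb, quadMatrix, QuadraticAlgebra.re_one] using hx 0 0
  · simpa [quadEmb, quadMatrix, QuadraticAlgebra.im_one] using hx 0 1

/-- For an unramified quadratic extension `E`, every element of `Eˣ` is the product of an element
of `Fˣ` and an element of `GL₂(𝒪)`. -/
theorem exists_scalar_mul_integral [IsNonarchimedeanLocalField F] (hres : ringChar 𝓀[F] ≠ 2)
    {D : F} (hD : IsUnramifiedQuadratic D) (x : (QuadraticAlgebra F D 0)ˣ) :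
    ∃ s : Fˣ, ∃ g ∈ integralGL F, quadEmb D x = Matrix.GeneralLinearGroup.scalar (Fin 2) s * g := by
  obtain ⟨hD1, hD2⟩ := hD
  set a := (x : QuadraticAlgebra F D 0).re with ha
  set c := (x : QuadraticAlgebra F D 0).im with hc
  -- The scalar `s` is the coordinate of `x` of larger absolute value; what needs proof is that the
  -- norm of `x / s` is a unit.
  suffices h : ∃ s : F, s ≠ 0 ∧ valuation F (a / s) ≤ 1 ∧ valuation F (c / s) ≤ 1 ∧
      valuation F ((a / s) ^ 2 - (c / s) ^ 2 * D) = 1 by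
    obtain ⟨s, hs, h1, h2, h3⟩ := h
    have hcoe : ((Matrix.GeneralLinearGroup.scalar (Fin 2) (Units.mk0 s hs)⁻¹ * quadEmb D x :
        GL (Fin 2) F) : Matrix (Fin 2) (Fin 2) F) = !![a / s, c / s; c / s * D, a / s] := by
      rw [coe_scalar_mul]
      ext i j
      fin_cases i <;> fin_cases j <;> simp [quadEmb, quadMatrix, ← ha, ← hc] <;> ring
    refine ⟨Units.mk0 s hs, Matrix.GeneralLinearGroup.scalar (Fin 2) (Units.mk0 s hs)⁻¹ *
      quadEmb D x, ⟨fun i j => ?_, ?_⟩, ?_⟩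
    · rw [hcoe]
      fin_cases i <;> fin_cases j
      · exact h1
      · exact h2
      · simpa [hD1] using h2
      · exact h1
    · rw [hcoe, Matrix.det_fin_two_of, ← h3]
      congr 1
      ring
    · rw [← mul_assoc, ← map_mul, mul_inv_cancel, map_one, one_mul]
  have hle : ∀ u w : F, valuation F u ≤ 1 → valuation F w ≤ 1 →
      valuation F (u ^ 2 - w ^ 2 * D) ≤ 1 := fun u w hu hw => by
    refine (Valuation.map_sub _ _ _).trans (max_le ?_ ?_)
    · rw [map_pow]
      exact pow_le_one' hu 2
    · rw [map_mul, map_pow, hD1, mul_one]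
      exact pow_le_one' hw 2
  by_cases hac : valuation F a ≤ valuation F c
  · have hc0 : c ≠ 0 := by
      intro h0
      have ha0 : a = 0 := by simpa [h0] using hac
      have hx : (x : QuadraticAlgebra F D 0) = 0 := QuadraticAlgebra.ext ha0 h0
      exact x.ne_zero hx
    have h1 : valuation F (a / c) ≤ 1 := by
      rw [map_div₀]
      exact div_le_one_of_le₀ hac zero_le
    have h2 : valuation F (c / c) ≤ 1 := by rw [div_self hc0, map_one]
    -- A non-unit norm would make `D` a square modulo `𝔭`, hence a square by Hensel.
    refine ⟨c, hc0, h1, h2, le_antisymm (hle _ _ h1 h2) (not_lt.1 fun hlt => hD2 ?_)⟩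
    rw [div_self hc0, one_pow, one_mul] at hlt
    exact isSquare_of_valuation_sq_sub_lt_one hres hD1 hlt
  · rw [not_le] at hac
    have ha0 : a ≠ 0 := by
      rintro h0
      simp [h0] at hac
    have h2 : valuation F (c / a) < 1 := by
      rw [map_div₀]
      exact (div_lt_one₀ (by simpa [zero_lt_iff] using ha0)).2 hac
    refine ⟨a, ha0, by rw [div_self ha0, map_one], h2.le, ?_⟩
    rw [div_self ha0, one_pow, Valuation.map_sub_swap, sub_eq_add_neg,
      Valuation.map_add_eq_of_lt_right, Valuation.map_neg, map_one]
    rw [Valuation.map_neg, map_one, map_mul, map_pow, hD1, mul_one]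
    exact pow_lt_one₀ zero_le h2 two_ne_zero

/-- Modulo scalars, which drop out of conjugation, `Eˣ` lies in `GL₂(𝒪)`. -/
theorem quadEmb_conj_mem [IsNonarchimedeanLocalField F] (hres : ringChar 𝓀[F] ≠ 2)
    {ϖ : 𝒪[F]} (hϖ : Irreducible ϖ) {r : ℕ} {D : F} (hD : IsUnramifiedQuadratic D)
    (x : (QuadraticAlgebra F D 0)ˣ) {k : GL (Fin 2) F} (hk : k ∈ congruenceGroup ϖ r) :
    quadEmb D x * k * (quadEmb D x)⁻¹ ∈ congruenceGroup ϖ r := by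
  obtain ⟨s, g, hg, hx⟩ := exists_scalar_mul_integral hres hD x
  have he : quadEmb D x * k * (quadEmb D x)⁻¹ = g * k * g⁻¹ := by
    rw [hx, mul_inv_eq_iff_eq_mul, ← mul_assoc (g * k * g⁻¹), ← scalar_mul_comm]
    group
  rw [he]
  exact conj_mem_congruenceGroup hϖ hg hk

theorem quadMatrix_mul_comm {D : F} (b : QuadraticAlgebra F D 0) (x : (QuadraticAlgebra F D 0)ˣ) :
    quadMatrix D b * (quadEmb D x : Matrix (Fin 2) (Fin 2) F) = quadEmb D x * quadMatrix D b := by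
  change quadMatrix D b * quadMatrix D x = quadMatrix D x * quadMatrix D b
  rw [← map_mul, ← map_mul, mul_comm]

/-- The real part of `b` is controlled by triviality of `θ` on `Fˣ`, the coefficient of `√D` by
minimality of the conductor exponent. -/
theorem IsMinimalChar.isAntidiagonalParameter [IsNonarchimedeanLocalField F]
    (hres : ringChar 𝓀[F] ≠ 2) {ψ : AddChar F Circle} (hψ : IsUnramifiedChar ψ)
    {ϖ : 𝒪[F]} (hϖ : Irreducible ϖ) {r : ℕ} (hr : 1 ≤ r) {D : F} (hD : IsUnramifiedQuadratic D)
    {θ : (QuadraticAlgebra F D 0)ˣ →* Circle} {b : QuadraticAlgebra F D 0}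
    (h : IsMinimalChar ψ ϖ r θ b) : IsAntidiagonalParameter ϖ r (quadMatrix D b) := by
  have h0 := valuation_uniformizer_ne_zero hϖ
  have hre : b.re ∈ primePow ϖ (-(r : ℤ)) := by
    -- Evaluating `θ` on `1 + ϖ^r y` with `y ∈ 𝒪` gives `ψ(2 Re(b) ϖ^r y) = 1` for all `y`; then `2`
    -- is removed as a unit.
    have h1 : valuation F (2 * b.re * (ϖ : F) ^ (r : ℤ)) ≤ 1 := by
      refine (hψ.2 _).1 fun y => ?_
      have hy : (ϖ : F) ^ (r : ℤ) * y ∈ primePow ϖ r := ⟨y, rfl⟩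
      have hu : valuation F (1 + (ϖ : F) ^ (r : ℤ) * y) = 1 :=
        valuation_eq_one_of_sub_mem hϖ (n := r) (y := 1) (by omega)
          (by rwa [add_sub_cancel_left]) (map_one _)
      have hu0 : 1 + (ϖ : F) ^ (r : ℤ) * y ≠ 0 := fun hz => by simp only [hz, map_zero, zero_ne_one] at hu
      have h2 := h.trivial_on_base (Units.mk0 _ hu0)
      have h3 : ((Units.map (algebraMap F (QuadraticAlgebra F D 0) : F →* QuadraticAlgebra F D 0)
          (Units.mk0 _ hu0) : (QuadraticAlgebra F D 0)ˣ) : QuadraticAlgebra F D 0) - 1 =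
          algebraMap F _ ((ϖ : F) ^ (r : ℤ) * y) := by
        change algebraMap F (QuadraticAlgebra F D 0) (1 + (ϖ : F) ^ (r : ℤ) * y) - 1 = _
        rw [map_add, map_one, add_sub_cancel_left]
      rw [h.spec, h3, mul_comm b, ← Algebra.smul_def, map_smul, QuadraticAlgebra.trace_def] at h2
      · rw [← h2, smul_eq_mul]
        congr 1
        ring
      · rw [h3]
        exact ⟨by rwa [QuadraticAlgebra.algebraMap_re],
          by simpa only [QuadraticAlgebra.algebraMap_im] using primePow_zero_mem hϖ r⟩
    rw [mem_primePow_iff hϖ, ← one_mul (valuation F b.re), ← valuation_two_eq_one hres, ← map_mul,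
      zpow_neg, ← one_div, le_div_iff₀ (zpow_pos (zero_lt_iff.2 h0) _), ← map_zpow₀, ← map_mul]
    exact h1
  refine ⟨fun i j => ?_, hre, hre, ?_⟩
  · fin_cases i <;> fin_cases j
    · exact h.mem.1
    · exact h.mem.2
    · exact primePow_mul_integer hϖ h.mem.2 hD.1.le
    · exact h.mem.1
  · change valuation F b.im = _
    refine le_antisymm ((mem_primePow_iff hϖ).1 h.mem.2) (not_lt.1 fun hlt => ?_)
    have him : b.im ∈ primePow ϖ (-(2 * r : ℤ) + 1) := by
      have h1 : (ϖ : F) ^ (2 * r : ℤ) * b.im ∈ primePow ϖ 1 := by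
        refine mem_primePow_one_of_lt hϖ ?_
        rw [zpow_neg, ← one_div, lt_div_iff₀ (zpow_pos (zero_lt_iff.2 h0) _)] at hlt
        rwa [map_mul, map_zpow₀, mul_comm]
      rwa [zpow_mul_mem_primePow_iff hϖ, sub_eq_neg_add] at h1
    -- If `b.im` were in `𝔭^{-2r+1}`, then `θ` would be trivial on `1 + 𝔭_E^{2r-1}`. The formula for
    -- `θ` applies there because `2r - 1 ≥ r`.
    have hmem := mem_lowerBounds.1 h.conductor.2 (2 * r - 1) fun x _ _ hx => by
      have hx' : (x : QuadraticAlgebra F D 0) - 1 ∈ primePowE ϖ D r :=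
        ⟨primePow_mono hϖ (by omega) hx.1, primePow_mono hϖ (by omega) hx.2⟩
      rw [h.spec x hx']
      refine isUnramifiedChar_apply_eq_one hψ hϖ ?_
      have he : QuadraticAlgebra.trace (b * ((x : QuadraticAlgebra F D 0) - 1)) =
          2 * (b.re * ((x : QuadraticAlgebra F D 0) - 1).re +
            b.im * ((x : QuadraticAlgebra F D 0) - 1).im * D) := by
        rw [QuadraticAlgebra.trace_def, QuadraticAlgebra.re_mul]
        ring
      rw [he]
      refine primePow_integer_mul hϖ (valuation_two_eq_one hres).le (primePow_add_mem hϖ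
        (primePow_mul_mem hϖ hre hx'.1 (by ring)) (primePow_mul_integer hϖ
        (primePow_mul_mem hϖ him hx.2 ?_) hD.1.le))
      rw [Nat.cast_sub (by omega)]
      push_cast
      ring
    omega

theorem IsMinimalChar.areCompatibleChars {ψ : AddChar F Circle} (hψ : IsUnramifiedChar ψ)
    {ϖ : 𝒪[F]} (hϖ : Irreducible ϖ) {r : ℕ} (hr : 1 ≤ r) {D : F}
    {θ : (QuadraticAlgebra F D 0)ˣ →* Circle} {b : QuadraticAlgebra F D 0}
    (h : IsMinimalChar ψ ϖ r θ b) (hb : quadMatrix D b ∈ primePowMat ϖ (-(2 * r : ℤ))) :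
    AreCompatibleChars (quadEmb D) (congruenceSubgroup hϖ hr) (fun x => (θ x : ℂ))
      (fun k => (thetaChar ψ (quadMatrix D b) k : ℂ)) where
  map_mul_left x y := by rw [map_mul, Circle.coe_mul]
  map_one_left := by rw [map_one, Circle.coe_one]
  map_mul_right k hk l hl := by rw [thetaChar_mul hψ hϖ hb hk hl, Circle.coe_mul]
  map_one_right := by rw [thetaChar_one, Circle.coe_one]
  agree x hx := by
    rw [h.spec x (primePowE_of_quadEmb_mem hx), ← trace_quadMatrix_mul]
    rfl

variable {V : Type*} [NormedAddCommGroup V] [InnerProductSpace ℂ V]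

/-- The function equal to `Λ` on `J` and zero elsewhere lies in the induced space, and right
translation by all of `J`, not only `J¹`, acts on it through `Λ`. -/
theorem exists_isMinimalVector [IsNonarchimedeanLocalField F] (hres : ringChar 𝓀[F] ≠ 2)
    {ψ : AddChar F Circle} (hψ : IsUnramifiedChar ψ) {ϖ : 𝒪[F]} (hϖ : Irreducible ϖ)
    {r : ℕ} (hr : 1 ≤ r) {D : F} (hD : IsUnramifiedQuadratic D)
    {θ : (QuadraticAlgebra F D 0)ˣ →* Circle} {b : QuadraticAlgebra F D 0}
    (h : IsMinimalChar ψ ϖ r θ b) {π : Representation ℂ (GL (Fin 2) F) V}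
    (hreal : IsRealisedOn π (compactInd ψ ϖ r θ b)) : ∃ v : V, IsMinimalVector ψ ϖ r θ b π v := by
  have hb := (h.isAntidiagonalParameter hres hψ hϖ hr hD).mem
  have hc := h.areCompatibleChars hψ hϖ hr hb
  have hconj : ∀ x : (QuadraticAlgebra F D 0)ˣ, ∀ k ∈ congruenceSubgroup hϖ hr,
      (quadEmb D x)⁻¹ * k * quadEmb D x ∈ congruenceSubgroup hϖ hr ∧
      (thetaChar ψ (quadMatrix D b) ((quadEmb D x)⁻¹ * k * quadEmb D x) : ℂ) =
        (thetaChar ψ (quadMatrix D b) k : ℂ) := fun x k hk => by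
    have h1 := quadEmb_conj_mem hres hϖ hD x⁻¹ hk
    have h2 := thetaChar_conj ψ (quadMatrix_mul_comm b x⁻¹) k
    rw [map_inv, inv_inv] at h1 h2
    exact ⟨h1, by rw [h2]⟩
  set f := extendChar (quadEmb D) (congruenceSubgroup hϖ hr) (fun x => (θ x : ℂ))
      (fun k => (thetaChar ψ (quadMatrix D b) k : ℂ)) with hf
  have hfW : f ∈ compactInd ψ ϖ r θ b := by
    refine ⟨isRightSmooth_of_thetaChar hψ hϖ hr hb fun g k hk => hc.extendChar_mul_right g hk,
      fun x k hk g => ?_, {1}, isCompact_singleton, fun g hg => ?_⟩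
    · rw [mul_assoc, hf, hc.extendChar_mul_left, hc.extendChar_mul_left_of_normalized g hk hconj,
        Circle.coe_mul, mul_assoc]
    · obtain ⟨x, k, hk, he⟩ := exists_of_extendChar_ne_zero hg
      exact ⟨x, k, hk, 1, rfl, by rw [he, mul_one]⟩
  have hf0 : f ≠ 0 := fun h0 => by
    have := hc.extendChar_one
    rw [← hf, h0] at this
    exact zero_ne_one this
  obtain ⟨v, hv0, hv⟩ := hreal.exists_vector hfW hf0
  refine ⟨v, hv0, fun x _ k hk => hv _ _ fun g => ?_⟩
  rw [← mul_assoc, hf, hc.extendChar_mul_right _ hk,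
    hc.extendChar_mul_right_of_normalizes g (hconj x) fun k hk => quadEmb_conj_mem hres hϖ hD x hk,
    Circle.coe_mul]
  ring

theorem IsMinimalVector.isLocalisedAt {ψ : AddChar F Circle} {ϖ : 𝒪[F]} (hϖ : Irreducible ϖ)
    {r : ℕ} {D : F} {θ : (QuadraticAlgebra F D 0)ˣ →* Circle} {b : QuadraticAlgebra F D 0}
    {π : Representation ℂ (GL (Fin 2) F) V} {v : V} (h : IsMinimalVector ψ ϖ r θ b π v) :
    IsLocalisedAt ψ ϖ r (quadMatrix D b) π v := fun k hk => by
  have h1 := h.2 1 ⟨by simpa using primePow_zero_mem hϖ 1, by simpa using primePow_zero_mem hϖ 1⟩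
    k hk
  rwa [map_one, one_mul, map_one, one_mul] at h1

end Supercuspidal

/-! ### Microlocal lift vectors of principal series -/

section PrincipalSeries

set_option linter.unusedSectionVars false

variable {F : Type*} [Field F] [ValuativeRel F] [TopologicalSpace F]

theorem normAbs_mul [IsNonarchimedeanLocalField F] (x y : F) :
    normAbs (x * y) = normAbs x * normAbs y := by
  simp [normAbs]

theorem normAbs_of_valuation_eq_one [IsNonarchimedeanLocalField F] {x : F}
    (hx : valuation F x = 1) : normAbs x = 1 := by
  simp [normAbs, hx]

theorem normAbs_nonneg [IsNonarchimedeanLocalField F] (x : F) : 0 ≤ normAbs x :=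
  NNReal.coe_nonneg _

open Classical in
/-- The function `x ↦ χ(x) |x| ^ (1 / 2)` on `F`, extended by zero. -/
noncomputable def normalisedChar [IsNonarchimedeanLocalField F] (χ : Fˣ →* Circle) (x : F) : ℂ :=
  if h : x = 0 then 0 else (χ (Units.mk0 x h) : ℂ) * ((normAbs x ^ (1 / 2 : ℝ) : ℝ) : ℂ)

theorem normalisedChar_unit [IsNonarchimedeanLocalField F] (χ : Fˣ →* Circle) (x : Fˣ) :
    normalisedChar χ (x : F) = (χ x : ℂ) * ((normAbs (x : F) ^ (1 / 2 : ℝ) : ℝ) : ℂ) := by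
  rw [normalisedChar, dif_neg x.ne_zero, Units.mk0_val]

theorem normalisedChar_mul [IsNonarchimedeanLocalField F] (χ : Fˣ →* Circle) (x y : F) :
    normalisedChar χ (x * y) = normalisedChar χ x * normalisedChar χ y := by
  by_cases hx : x = 0
  · simp [normalisedChar, hx]
  by_cases hy : y = 0
  · simp [normalisedChar, hy]
  lift x to Fˣ using isUnit_iff_ne_zero.2 hx
  lift y to Fˣ using isUnit_iff_ne_zero.2 hy
  rw [← Units.val_mul, normalisedChar_unit, normalisedChar_unit, normalisedChar_unit, map_mul,
    Units.val_mul, normAbs_mul, Real.mul_rpow (normAbs_nonneg _) (normAbs_nonneg _),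
    Circle.coe_mul, Complex.ofReal_mul]
  ring

theorem normalisedChar_of_valuation_eq_one [IsNonarchimedeanLocalField F] (χ : Fˣ →* Circle)
    {x : Fˣ} (hx : valuation F (x : F) = 1) : normalisedChar χ (x : F) = (χ x : ℂ) := by
  rw [normalisedChar_unit, normAbs_of_valuation_eq_one hx, Real.one_rpow, Complex.ofReal_one,
    mul_one]

variable (F) in
/-- The subgroup of upper triangular matrices. -/
def borelSubgroup : Subgroup (GL (Fin 2) F) where
  carrier := {p | p 1 0 = 0}
  one_mem' := by simp
  mul_mem' := by
    intro p p' hp hp'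
    simp only [Set.mem_ofPred_eq] at *
    simp [Matrix.mul_apply, hp, hp']
  inv_mem' := by
    intro p hp
    simp only [Set.mem_ofPred_eq] at *
    rw [coe_inv_eq]
    simp [hp]

theorem tauMatrix_mem {ϖ : 𝒪[F]} (hϖ : Irreducible ϖ) {r : ℕ} {b : Fˣ}
    (hb : valuation F (b : F) = 1) : tauMatrix ϖ r b ∈ primePowMat ϖ (-(2 * r : ℤ)) := by
  intro i j
  rw [tauMatrix, Matrix.smul_apply, smul_eq_mul, zpow_mul_mem_primePow_iff hϖ, sub_self,
    mem_primePow_zero_iff hϖ]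
  fin_cases i <;> fin_cases j <;> simp [hb]

theorem tauMatrix_mul_comm {ϖ : 𝒪[F]} {r : ℕ} {b t₁ t₂ : F} :
    (ϖ : F) ^ (-(2 * r : ℤ)) • !![b, 0; 0, -b] * !![t₁, 0; 0, t₂] =
      !![t₁, 0; 0, t₂] * (ϖ : F) ^ (-(2 * r : ℤ)) • !![b, 0; 0, -b] := by
  rw [smul_mul_assoc, mul_smul_comm]
  simp [mul_comm]

/-- On upper triangular elements of `K(r)` the diagonal entries are units `1 + ϖ^r x₀`, `1 + ϖ^r
x₁`. The absolute value factor is therefore `1`, and both characters equal `ψ(b(x₀ - x₁)ϖ^{-r})`. -/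
theorem IsCharParameter.areCompatibleChars [IsNonarchimedeanLocalField F] {ψ : AddChar F Circle}
    (hψ : IsUnramifiedChar ψ) {ϖ : 𝒪[F]} (hϖ : Irreducible ϖ) {r : ℕ} (hr : 1 ≤ r)
    {χ : Fˣ →* Circle} {b : Fˣ} (h : IsCharParameter ψ ϖ r χ b) :
    AreCompatibleChars (borelSubgroup F).subtype (congruenceSubgroup hϖ hr)
      (fun p => normalisedChar χ ((p : GL (Fin 2) F) 0 0 / (p : GL (Fin 2) F) 1 1))
      (fun k => (thetaChar ψ (tauMatrix ϖ r b) k : ℂ)) where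
  map_mul_left p q := by
    have hp : (p : GL (Fin 2) F) 1 0 = 0 := p.2
    have hq : (q : GL (Fin 2) F) 1 0 = 0 := q.2
    rw [← normalisedChar_mul, div_mul_div_comm]
    simp [Matrix.mul_apply, hp, hq]
  map_one_left := by
    have := normalisedChar_of_valuation_eq_one χ (x := 1) (by simp)
    simpa using this
  map_mul_right k hk l hl := by
    rw [thetaChar_mul hψ hϖ (tauMatrix_mem hϖ h.1) hk hl, Circle.coe_mul]
  map_one_right := by rw [thetaChar_one, Circle.coe_one]
  agree p hp := by
    have hp' : (p : GL (Fin 2) F) ∈ congruenceGroup ϖ r := hp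
    have key : ∀ i, ∃ (x : 𝒪[F]) (u : Fˣ), (u : F) = (p : GL (Fin 2) F) i i ∧
        (u : F) = 1 + (ϖ : F) ^ r * (x : F) ∧ valuation F (u : F) = 1 := fun i => by
      have h1 := hp' i i
      rw [Matrix.one_apply_eq] at h1
      have h2 : valuation F ((p : GL (Fin 2) F) i i) = 1 :=
        valuation_eq_one_of_sub_mem hϖ (n := r) (by omega) h1 (map_one _)
      have h3 : (p : GL (Fin 2) F) i i ≠ 0 := fun h => by simp [h] at h2
      obtain ⟨x, hx⟩ := h1
      refine ⟨x, Units.mk0 _ h3, rfl, ?_, h2⟩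
      rw [Units.val_mk0, ← zpow_natCast, ← hx, add_sub_cancel]
    obtain ⟨x₀, u₀, hu₀, hx₀, hv₀⟩ := key 0
    obtain ⟨x₁, u₁, hu₁, hx₁, hv₁⟩ := key 1
    rw [← hu₀, ← hu₁, ← Units.val_div_eq_div_val, normalisedChar_of_valuation_eq_one χ (by
      rw [Units.val_div_eq_div_val, map_div₀, hv₀, hv₁, div_one]), map_div, h.2 x₀ u₀ hx₀,
      h.2 x₁ u₁ hx₁, ← AddChar.map_sub_eq_div]
    congr 2
    have he : (tauMatrix ϖ r b *
        (((p : GL (Fin 2) F) : Matrix (Fin 2) (Fin 2) F) - 1)).trace =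
        (ϖ : F) ^ (-(2 * r : ℤ)) * (b * ((p : GL (Fin 2) F) 0 0 - 1) -
          b * ((p : GL (Fin 2) F) 1 1 - 1)) := by
      rw [tauMatrix, smul_mul_assoc, Matrix.trace_smul, smul_eq_mul]
      congr 1
      simp only [Matrix.trace_fin_two, Matrix.mul_apply, Fin.sum_univ_two]
      simp
      ring
    have hz : (ϖ : F) ^ (-(r : ℤ)) = (ϖ : F) ^ (-(2 * r : ℤ)) * (ϖ : F) ^ r := by
      rw [← zpow_natCast, ← zpow_add₀ (uniformizer_coe_ne_zero hϖ)]
      congr 1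
      ring
    change _ = (tauMatrix ϖ r b * (((p : GL (Fin 2) F) : Matrix (Fin 2) (Fin 2) F) - 1)).trace
    rw [he, ← hu₀, ← hu₁, hx₀, hx₁, hz]
    ring

variable {V : Type*} [NormedAddCommGroup V] [InnerProductSpace ℂ V]

/-- The function is supported on `B K(r)`, with `B` the upper triangular group. Right translation by
`diag(t₁, t₂)` with unit entries is harmless because such matrices normalise `K(r)` and commute with
`τ(χ)`. -/
theorem exists_isMicrolocalLift [IsNonarchimedeanLocalField F] {ψ : AddChar F Circle}
    (hψ : IsUnramifiedChar ψ) {ϖ : 𝒪[F]} (hϖ : Irreducible ϖ) {r : ℕ} (hr : 1 ≤ r)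
    {χ : Fˣ →* Circle} {b : Fˣ} (h : IsCharParameter ψ ϖ r χ b)
    {π : Representation ℂ (GL (Fin 2) F) V} (hreal : IsRealisedOn π (principalSeries χ)) :
    ∃ v : V, IsMicrolocalLift ψ ϖ r χ b π v := by
  have hc := h.areCompatibleChars hψ hϖ hr
  set f := extendChar (borelSubgroup F).subtype (congruenceSubgroup hϖ hr)
      (fun p => normalisedChar χ ((p : GL (Fin 2) F) 0 0 / (p : GL (Fin 2) F) 1 1))
      (fun k => (thetaChar ψ (tauMatrix ϖ r b) k : ℂ)) with hf
  have hfW : f ∈ principalSeries χ := by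
    refine ⟨isRightSmooth_of_thetaChar hψ hϖ hr (tauMatrix_mem hϖ h.1)
      fun g k hk => hc.extendChar_mul_right g hk, fun p t₁ t₂ h₁ h₂ h₃ g => ?_⟩
    have h1 := hc.extendChar_mul_left ⟨p, h₃⟩ g
    dsimp only at h1
    rw [h₁, h₂, ← Units.val_div_eq_div_val, normalisedChar_unit, Units.val_div_eq_div_val] at h1
    exact h1
  have hf0 : f ≠ 0 := fun h0 => by
    have := hc.extendChar_one
    rw [← hf, h0] at this
    exact zero_ne_one this
  obtain ⟨v, hv0, hv⟩ := hreal.exists_vector hfW hf0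
  refine ⟨v, hv0, fun d t₁ t₂ hd h₁ h₂ k hk => hv _ _ fun g => ?_⟩
  have hdB : d ∈ borelSubgroup F := by
    change d 1 0 = 0
    rw [hd]
    rfl
  have hdK : d ∈ integralGL F := by
    refine ⟨fun i j => ?_, ?_⟩
    · rw [hd]
      fin_cases i <;> fin_cases j <;> simp [h₁, h₂]
    · rw [hd, Matrix.det_fin_two_of]
      simp [h₁, h₂]
  have hcomm : tauMatrix ϖ r b * d = d * tauMatrix ϖ r b := by
    rw [hd]
    exact tauMatrix_mul_comm
  have h3 := hc.extendChar_mul_right_of_normalizes g (d := ⟨d, hdB⟩) (fun l hl => by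
      have h4 : d⁻¹ * l * d ∈ congruenceGroup ϖ r := by
        simpa using conj_mem_congruenceGroup hϖ (inv_mem hdK) hl
      refine ⟨h4, congrArg _ ?_⟩
      have h5 := thetaChar_conj ψ hcomm (d⁻¹ * l * d)
      have h6 : d * (d⁻¹ * l * d) * d⁻¹ = l := by group
      rw [h6] at h5
      exact h5.symm)
    fun l hl => conj_mem_congruenceGroup hϖ hdK hl
  have h4 : normalisedChar χ (d 0 0 / d 1 1) = (χ (t₁ / t₂) : ℂ) := by
    have h5 : d 0 0 / d 1 1 = ((t₁ / t₂ : Fˣ) : F) := by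
      rw [hd, Units.val_div_eq_div_val]
      rfl
    rw [h5, normalisedChar_of_valuation_eq_one]
    rw [Units.val_div_eq_div_val, map_div₀, h₁, h₂, div_one]
  dsimp only [Subgroup.coe_subtype] at h3
  rw [← mul_assoc, hf, hc.extendChar_mul_right _ hk, h3, h4, Circle.coe_mul]
  ring

theorem IsMicrolocalLift.isLocalisedAt {ψ : AddChar F Circle} {ϖ : 𝒪[F]} {r : ℕ}
    {χ : Fˣ →* Circle} {b : Fˣ} {π : Representation ℂ (GL (Fin 2) F) V} {v : V}
    (h : IsMicrolocalLift ψ ϖ r χ b π v) : IsLocalisedAt ψ ϖ r (tauMatrix ϖ r b) π v :=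
  fun k hk => by
  have h1 := h.2 1 1 1 (by simp [Matrix.one_fin_two]) (by simp) (by simp) k hk
  rwa [one_mul, div_one, map_one, one_mul] at h1

/-- The conjugate `c_t τ(χ) c_t⁻¹`. -/
def translatedTau (ϖ : 𝒪[F]) (r : ℕ) (b t : F) : Matrix (Fin 2) (Fin 2) F :=
  (ϖ : F) ^ (-(2 * r : ℤ)) • !![0, b ^ 2 / t; t, 0]

theorem translatedTau_isAntidiagonalParameter {ϖ : 𝒪[F]} (hϖ : Irreducible ϖ) {r : ℕ} {b t : F}
    (hb : valuation F b = 1) (ht : valuation F t = 1) :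
    IsAntidiagonalParameter ϖ r (translatedTau ϖ r b t) where
  mem i j := by
    rw [translatedTau, Matrix.smul_apply, smul_eq_mul, zpow_mul_mem_primePow_iff hϖ, sub_self,
      mem_primePow_zero_iff hϖ]
    fin_cases i <;> fin_cases j <;> simp [hb, ht]
  diag₀ := by simpa [translatedTau] using primePow_zero_mem hϖ _
  diag₁ := by simpa [translatedTau] using primePow_zero_mem hϖ _
  valuation_offDiag := by simp [translatedTau, hb, ht]

/-- The columns of `c_t` are eigenvectors of `(0, b²/t; t, 0)` with eigenvalues `b` and `-b`. -/
theorem translatedTau_mul [CharZero F] (ϖ : 𝒪[F]) (r : ℕ) (b t : Fˣ) :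
    translatedTau ϖ r b t * (translateMatrix b t : Matrix (Fin 2) (Fin 2) F) =
      translateMatrix b t * tauMatrix ϖ r b := by
  have hb := b.ne_zero
  have ht := t.ne_zero
  have hcoe : (translateMatrix b t : Matrix (Fin 2) (Fin 2) F) =
      !![(b : F) / t, -(1 / 2); 1, (t : F) / (2 * b)] := rfl
  rw [hcoe, translatedTau, tauMatrix, smul_mul_assoc, mul_smul_comm]
  congr 1
  ext i j
  fin_cases i <;> fin_cases j <;> simp [Matrix.mul_apply] <;> field_simp

theorem translateMatrix_mem_integralGL [CharZero F] (h2 : valuation F (2 : F) = 1) {b t : Fˣ}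
    (hb : valuation F (b : F) = 1) (ht : valuation F (t : F) = 1) :
    translateMatrix b t ∈ integralGL F := by
  have hb0 := b.ne_zero
  have ht0 := t.ne_zero
  have hcoe : (translateMatrix b t : Matrix (Fin 2) (Fin 2) F) =
      !![(b : F) / t, -(1 / 2); 1, (t : F) / (2 * b)] := rfl
  refine ⟨fun i j => ?_, ?_⟩
  · rw [hcoe]
    fin_cases i <;> fin_cases j <;> simp [hb, ht, h2]
  · have h : (b : F) / t * ((t : F) / (2 * b)) - -(1 / 2) * 1 = 1 := by
      field_simp
      norm_num
    rw [hcoe, Matrix.det_fin_two_of, h, map_one]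

end PrincipalSeries

end PadicPeriod

/-! ### The two period formulas -/

theorem mainTheorem10
    {F : Type*} [Field F] [CharZero F] [ValuativeRel F] [TopologicalSpace F]
    [IsNonarchimedeanLocalField F] (hres : ringChar 𝓀[F] ≠ 2)
    (ϖ : 𝒪[F]) (hϖ : Irreducible ϖ)
    (ψ : AddChar F Circle) (hψ : IsUnramifiedChar ψ)
    [MeasurableSpace (GL (Fin 2) F)] [BorelSpace (GL (Fin 2) F)]
    (μ : Measure (GL (Fin 2) F)) [μ.IsHaarMeasure]
    {V : Type*} [NormedAddCommGroup V] [InnerProductSpace ℂ V]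
    (π : Representation ℂ (GL (Fin 2) F) V) (hπ : IsSmoothUnitaryIrrep π)
    (r : ℕ) (hr : 1 ≤ r) (hcond : HasConductorExponent ϖ π (4 * r)) :
    (IsSupercuspidal π →
      ∀ (D : F), IsUnramifiedQuadratic D →
      ∀ (θ : (QuadraticAlgebra F D 0)ˣ →* Circle) (b : QuadraticAlgebra F D 0),
        IsMinimalChar ψ ϖ r θ b → IsRealisedOn π (compactInd ψ ϖ r θ b) →
        (∃ v : V, IsMinimalVector ψ ϖ r θ b π v) ∧
        ∀ v : V, IsMinimalVector ψ ϖ r θ b π v →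
          localPeriod μ ϖ π (2 * r) (((‖v‖⁻¹ : ℝ) : ℂ) • v) =
            localZeta (residueCard F) 1 * (residueCard F : ℂ) ^ (-(r : ℤ))) ∧
    (∀ χ : Fˣ →* Circle, Continuous χ → HasCharConductor ϖ χ (2 * r) →
      IsRealisedOn π (principalSeries χ) →
      ∀ b : Fˣ, IsCharParameter ψ ϖ r χ b →
        (∃ v : V, IsMicrolocalLift ψ ϖ r χ b π v) ∧
        ∀ v : V, IsMicrolocalLift ψ ϖ r χ b π v →
          ∀ t : Fˣ, valuation F (t : F) = 1 →
            localPeriod μ ϖ π (2 * r) (((‖v‖⁻¹ : ℝ) : ℂ) • π (translateMatrix b t) v) =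
              localZeta (residueCard F) 1 * (residueCard F : ℂ) ^ (-(r : ℤ))) := by
  refine ⟨fun _ D hD θ b hθ hreal => ⟨?_, fun v hv => ?_⟩, fun χ _ _ hreal b hb =>
    ⟨?_, fun v hv t ht => ?_⟩⟩
  · exact exists_isMinimalVector hres hψ hϖ hr hD hθ hreal
  · exact (hv.isLocalisedAt hϖ).localPeriod_eq μ hψ hϖ hr
      (hθ.isAntidiagonalParameter hres hψ hϖ hr hD) hπ hv.1
  · exact exists_isMicrolocalLift hψ hϖ hr hb hreal
  · have hloc := hv.isLocalisedAt.translate hϖ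
      (translateMatrix_mem_integralGL (valuation_two_eq_one hres) hb.1 ht)
      (translatedTau_mul ϖ r b t)
    -- By unitarity, normalising by `‖v‖` is the same as normalising the translated vector by its
    -- own norm.
    have hnorm : ‖π (translateMatrix b t) v‖ = ‖v‖ := by
      rw [@norm_eq_sqrt_re_inner ℂ, hπ.unitary, ← @norm_eq_sqrt_re_inner ℂ]
    rw [← hnorm]
    refine hloc.localPeriod_eq μ hψ hϖ hr (translatedTau_isAntidiagonalParameter hϖ hb.1 ht) hπ ?_
    rw [← norm_ne_zero_iff, hnorm, norm_ne_zero_iff]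
    exact hv.1
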